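/- **Model.** A probabilistic client with private working space accesses a server memory, indexed by addresses; an observer sees the access pattern, that is, the sequence of all read and write operations with their addresses, and nothing else. An array of $n$ elements of a linearly ordered set is stored in the memory. **Bucket oblivious random permutation (ORP)** with bucket size $Z\ge 1$. Let $B=2^L$ be the smallest power of two with $B\ge 2n/Z$. Give each element an independent uniformly random key in $\{0,\dots,B-1\}$, divide the array evenly into $B$ groups and put the $j$-th group, padded with dummies, into a bucket $A^{(0)}_j$ of size $Z$. For $i=0,\dots,L-1$ and $j=0,\dots,B/2-1$, with $j'=\lfloor j/2^i\rfloor 2^i$, read the buckets $A^{(i)}_{j'+j}$ and $A^{(i)}_{j'+j+2^i}$ and move their real elements into the buckets $A^{(i+1)}_{2j}$ and $A^{(i+1)}_{2j+1}$ according to whether the $(i+1)$-st most significant bit of the key is $0$ or $1$, padding with dummies to size $Z$; abort if one of the two would receive more than $Z$ real elements. Finally, for each of the buckets $A^{(L)}_0,\dots,A^{(L)}_{B-1}$ in turn, remove the dummies, permute the real elements uniformly at random (privately), and append them to the output array. **Bucket oblivious sort** runs bucket ORP and then a comparison-based sort $S$ on its output array. Here $S$ is any (possibly randomized, not necessarily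 oblivious) terminating program that copies elements between memory and registers, whose control flow and addresses depend only on comparisons of elements and on private coins, and which always sorts every array of length $n$ over every linearly ordered set. Let $\epsilon(n,Z)=\frac{2n}{Z}\log_2\!\left(\frac{2n}{Z}\right)e^{-Z/6}$, read as $0$ if $2n<Z$. **Theorem.** Let $n\ge 0$, $Z\ge1$ and let $S$ be such a comparison-based sort. Write $\mathrm{sort}(X)$ for the nondecreasing rearrangement of an array $X$ of length $n$. 1. (Correctness.) For every array $X$ of length $n$, bucket oblivious sort aborts on $X$ with probability at most $\epsilon(n,Z)$, and every run that does not abort outputs $\mathrm{sort}(X)$. 2. (Obliviousness.) There is a distribution $\mathsf{Sim}$ on access patterns, which depends only on $n$, $Z$ and $S$, such that for every array $X$ of $n$ pairwise distinct elements the joint distributions $$\bigl(\mathsf{Sim},\ \mathrm{sort}(X)\bigr)\quad\text{and}\quad\bigl(\text{access pattern on } X,\ \text{output on } X\bigr)$$ are $\epsilon(n,Z)$-statistically indistinguishable: no unbounded randomized distinguisher has advantage greater than $\epsilon(n,Z)$. 3. (Ties.) If each element is tagged with its initial position, the tagged array is sorted in the lexicographic order, and the tags are dropped from the output, then 1 and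 2, with the same $\mathsf{Sim}$, hold for all arrays $X$ of length $n$, also with repeated elements. -/

import Mathlib

/-! ### The client–server model

The client is a probabilistic program with private working space. The data lies in a server
memory, whose cells are indexed by logical addresses `0, 1, 2, …`. The observer sees the sequence
of all accesses (kind and address), and nothing else. -/

/-- The kind of a memory access. -/
inductive AccessKind : Type
  | read
  | write

/-- What the observer sees of one memory access: its kind and its address. -/
abbrev Access : Type := AccessKind × ℕ

/-- A memory cell: an element (`⊥` for a dummy or a blank cell), with room for a routing key. -/
@[ext] structure Cell (α : Type) : Type where
  val : WithBot α
  key : ℕ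

/-- The dummy, which is also the content of an unused cell. -/
def Cell.dummy {α : Type} : Cell α := ⟨⊥, 0⟩

/-- The cells that hold an element, as opposed to a dummy. -/
def Cell.isReal {α : Type} (c : Cell α) : Bool :=
  WithBot.recBotCoe false (fun _ => true) c.val

/-- The state of the server: the memory, and the accesses made so far, in temporal order. -/
structure Server (α : Type) : Type where
  mem : ℕ → Cell α
  trace : List Access

/-- Probabilistic client programs. A run may abort; the accesses made before that stay recorded:
the program is a function `Server α → PMF (Option β × Server α)`. -/
abbrev Client (α : Type) : Type → Type := OptionT (StateT (Server α) PMF)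

namespace Client

variable {α : Type}

/-- Fetch the cell at address `a`. -/
noncomputable def read (a : ℕ) : Client α (Cell α) :=
  OptionT.lift (modifyGet fun s => (s.mem a, { s with trace := s.trace ++ [(.read, a)] }))

/-- Overwrite the cell at address `a`. -/
noncomputable def write (a : ℕ) (c : Cell α) : Client α Unit :=
  OptionT.lift (modify fun s =>
    { mem := Function.update s.mem a c, trace := s.trace ++ [(.write, a)] })

/-- Draw from a probability distribution, privately. -/
noncomputable def sample {β : Type} (p : PMF β) : Client α β :=
  OptionT.lift (StateT.lift p)

/-- Abort the program. -/
noncomputable def abort {β : Type} : Client α β := OptionT.fail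

/-- Fetch the `m` cells from address `a` on. -/
noncomputable def readList (a m : ℕ) : Client α (List (Cell α)) :=
  (List.range m).mapM fun s => read (a + s)

/-- Store the cells of the list `l` from address `a` on. -/
noncomputable def writeList (a : ℕ) (l : List (Cell α)) : Client α Unit :=
  (List.range l.length).forM fun s => write (a + s) (l.getD s Cell.dummy)

/-- Store `l`, padded with dummies to length `Z`, from address `a` on. -/
noncomputable def writeBucket (Z a : ℕ) (l : List (Cell α)) : Client α Unit :=
  (List.range Z).forM fun s => write (a + s) (l.getD s Cell.dummy)

/-- A uniformly random rearrangement of a list, made privately. -/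
noncomputable def shuffle (l : List (Cell α)) : Client α (List (Cell α)) := do
  let σ ← sample (PMF.uniformOfFintype (Equiv.Perm (Fin l.length)))
  pure (List.ofFn fun i => l.get (σ i))

/-- The server before the run: the array `X` at the addresses `0, …, n - 1`, all other cells
blank, nothing recorded. -/
def init {n : ℕ} (X : Fin n → α) : Server α where
  mem a := if h : a < n then ⟨(X ⟨a, h⟩ : α), 0⟩ else Cell.dummy
  trace := []

/-- The joint distribution of the access pattern and the output when `P` is run on the array `X`;
the output is what the `n` cells from address `out` on contain in the end, or `none` if the run
was aborted. -/
noncomputable def exec {n : ℕ} (P : Client α Unit) (out : ℕ) (X : Fin n → α) :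
    PMF (List Access × Option (Fin n → WithBot α)) :=
  (StateT.run (OptionT.run P) (init X)).map fun r =>
    (r.2.trace, r.1.map fun _ i => (r.2.mem (out + i)).val)

end Client

/-! ### Comparison-based programs -/

/-- Comparison-based programs. They have registers that hold memory cells, move cells between
registers and memory, and can branch only on comparisons of the elements in two registers and on
private coins: the elements themselves are opaque. -/
inductive CmpProg : Type
  /-- Stop. -/
  | halt : CmpProg
  /-- Copy the memory cell at address `a` into register `r`. -/
  | load (r a : ℕ) (next : CmpProg) : CmpProg
  /-- Copy register `r` into the memory cell at address `a`. -/
  | store (r a : ℕ) (next : CmpProg) : CmpProg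
  /-- Branch on whether the element in register `r` is at most the one in register `s`. -/
  | cmp (r s : ℕ) (next : Bool → CmpProg) : CmpProg
  /-- Branch on a private uniformly random element of `{0, …, m}`. -/
  | rand (m : ℕ) (next : Fin (m + 1) → CmpProg) : CmpProg

/-- Execution of a comparison-based program on the part of the memory that begins at address
`base`, with register contents `reg`. -/
noncomputable def CmpProg.run {α : Type} [LinearOrder α] (base : ℕ) :
    CmpProg → (ℕ → Cell α) → Client α Unit
  | .halt, _ => pure ()
  | .load r a next, reg => do
      let c ← Client.read (base + a)
      next.run base (Function.update reg r c)
  | .store r a next, reg => do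
      Client.write (base + a) (reg r)
      next.run base reg
  | .cmp r s next, reg => (next (decide ((reg r).val ≤ (reg s).val))).run base reg
  | .rand m next, reg => do
      let i ← Client.sample (PMF.uniformOfFintype (Fin (m + 1)))
      (next i).run base reg

/-- The functionality of sorting: the nondecreasing rearrangement of the array `X`. -/
def sortedArray {α : Type} [LinearOrder α] {n : ℕ} (X : Fin n → α) : Fin n → WithBot α :=
  fun i => ((X (Tuple.sort X i) : α) : WithBot α)

/-- `S` sorts in place the arrays of length `n` that begin at address `0`, over every linearly
ordered type (cells beyond the array, initially blank, may serve as working space). -/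
def CmpProg.Sorts (S : CmpProg) (n : ℕ) : Prop :=
  ∀ (α : Type) [LinearOrder α] (X : Fin n → α),
    ∀ o ∈ (Client.exec (S.run 0 fun _ => Cell.dummy) 0 X).support, o.2 = some (sortedArray X)

/-! ### Bucket oblivious random permutation and bucket oblivious sort -/

namespace Bucket

variable {α : Type}

/-- The number of levels: the least `L` with `2 ^ L ≥ 2 n / Z`. -/
def levels (n Z : ℕ) : ℕ := Nat.clog 2 ((2 * n) ⌈/⌉ Z)

/-- The number `B` of buckets: the smallest power of two that is at least `2 n / Z`. -/
def numBuckets (n Z : ℕ) : ℕ := 2 ^ levels n Z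

instance (n Z : ℕ) : NeZero (numBuckets n Z) := ⟨by simp [numBuckets]⟩

/-- The address of the `j`-th bucket (each of `Z` cells) of the `i`-th array of buckets; these
arrays lie one after the other behind the input array. -/
def addr (n Z i j : ℕ) : ℕ := n + (i * numBuckets n Z + j) * Z

/-- The address of the output array, behind the last array of buckets. -/
def outAddr (n Z : ℕ) : ℕ := addr n Z (levels n Z + 1) 0

/-- Divide the input evenly into `B` groups, give every element an independent uniformly random
key in `{0, …, B - 1}`, and store the `j`-th group, padded with dummies, as the `j`-th bucket of
the `0`-th array. -/
noncomputable def distribute (n Z : ℕ) : Client α Unit :=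
  (List.range (numBuckets n Z)).forM fun j => do
    let lo := j * n / numBuckets n Z
    let hi := (j + 1) * n / numBuckets n Z
    let g ← Client.readList lo (hi - lo)
    let g' ← g.mapM fun c => do
      let k ← Client.sample (PMF.uniformOfFintype (Fin (numBuckets n Z)))
      pure (⟨c.val, k⟩ : Cell α)
    Client.writeBucket Z (addr n Z 0 j) g'

/-- Read the buckets at `a₀` and `a₁`, and route their real elements to the buckets at `b₀` and
`b₁`, according to the `(i + 1)`-st most significant of the `L` bits of their keys; abort if more
than `Z` of them would go to the same bucket. -/
noncomputable def mergeSplit (Z L i a₀ a₁ b₀ b₁ : ℕ) : Client α Unit := do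
  let c₀ ← Client.readList a₀ Z
  let c₁ ← Client.readList a₁ Z
  let real := (c₀ ++ c₁).filter Cell.isReal
  let l₀ := real.filter fun c => !c.key.testBit (L - 1 - i)
  let l₁ := real.filter fun c => c.key.testBit (L - 1 - i)
  if Z < l₀.length ∨ Z < l₁.length then
    Client.abort
  else do
    Client.writeBucket Z b₀ l₀
    Client.writeBucket Z b₁ l₁

/-- Oblivious random bin assignment: a butterfly network of `mergeSplit` operations. -/
noncomputable def binAssign (n Z : ℕ) : Client α Unit := do
  distribute n Z
  (List.range (levels n Z)).forM fun i =>
    (List.range (numBuckets n Z / 2)).forM fun j =>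
      let j' := j / 2 ^ i * 2 ^ i
      mergeSplit Z (levels n Z) i
        (addr n Z i (j' + j)) (addr n Z i (j' + j + 2 ^ i))
        (addr n Z (i + 1) (2 * j)) (addr n Z (i + 1) (2 * j + 1))

/-- Bucket oblivious random permutation: assign the elements to random bins; then, bin after bin,
remove the dummies, permute the real elements uniformly at random, and append them (without their
keys) to the output array. -/
noncomputable def orp (n Z : ℕ) : Client α Unit := do
  binAssign n Z
  let _ ← (List.range (numBuckets n Z)).foldlM (init := 0) fun off j => do
    let c ← Client.readList (addr n Z (levels n Z) j) Z
    let l ← Client.shuffle (c.filter Cell.isReal)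
    Client.writeList (outAddr n Z + off) (l.map fun c => ⟨c.val, 0⟩)
    pure (off + l.length)
  pure ()

/-- Bucket oblivious sort: the comparison-based program `S` is run on the output of `orp`. -/
noncomputable def sort [LinearOrder α] (n Z : ℕ) (S : CmpProg) : Client α Unit := do
  orp n Z
  S.run (outAddr n Z) fun _ => Cell.dummy

/-- Access pattern and output of bucket oblivious sort on the array `X`. -/
noncomputable def execSort [LinearOrder α] {n : ℕ} (Z : ℕ) (S : CmpProg) (X : Fin n → α) :
    PMF (List Access × Option (Fin n → WithBot α)) :=
  (sort n Z S).exec (outAddr n Z) X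

/-- Bucket oblivious sort with ties broken by the initial positions: every element is tagged with
its index, the tagged array is sorted lexicographically, and the tags are dropped from the
output. -/
noncomputable def execSortTagged [LinearOrder α] {n : ℕ} (Z : ℕ) (S : CmpProg) (X : Fin n → α) :
    PMF (List Access × Option (Fin n → WithBot α)) :=
  (execSort Z S fun i => (toLex (X i, i) : α ×ₗ Fin n)).map fun o =>
    (o.1, o.2.map fun Y i => (Y i).map fun p => (ofLex p).1)

/-- The error bound `(2n/Z) · log₂(2n/Z) · e^(-Z/6)`, read as `0` if `2n/Z < 1`. -/
noncomputable def err (n Z : ℕ) : ℝ :=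
  2 * n / Z * max 0 (Real.logb 2 (2 * n / Z)) * Real.exp (-Z / 6)

end Bucket

/-! ### Statistical indistinguishability -/

/-- Every (randomized, unbounded) distinguisher tells `p` and `q` apart with advantage at
most `ε`. -/
def StatIndist {Ω : Type} (ε : ℝ) (p q : PMF Ω) : Prop :=
  ∀ A : Ω → PMF Bool, |((p.bind A) true).toReal - ((q.bind A) true).toReal| ≤ ε

/-- The simulated access pattern, jointly with the output `y` of a deterministic functionality, is
`ε`-indistinguishable from the real access pattern, jointly with the real output. -/
def Simulates {β : Type} (Sim : PMF (List Access)) (ε : ℝ) (y : β)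
    (real : PMF (List Access × Option β)) : Prop :=
  StatIndist ε (Sim.map fun t => (t, some y)) real

/-- Up to an abort with probability at most `ε`, the output is always `y`. -/
def Outputs {β : Type} (ε : ℝ) (y : β) (real : PMF (List Access × Option β)) : Prop :=
  (∀ o ∈ real.support, o.2 = none ∨ o.2 = some y) ∧
    ((real.map fun o => o.2) none).toReal ≤ ε

/-! ### Lists and permutations -/

/-! The proof compares the real run with an ideal one in which buckets never overflow, and
conditions both on the list of keyed elements.

Given the keys, the butterfly network is deterministic. Bucket `b` of array `i` should hold the
elements of a block of `2 ^ i` consecutive groups whose leading `i` key bits spell `b % 2 ^ i`; this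
is `content`, and `content_succ` says that one `mergeSplit` maintains it. Without overflow the
network therefore makes a fixed sequence of accesses, and its last buckets are the bins of equal
keys. What follows reveals only the loads of the bins and the accesses of `S` on the concatenation
of the shuffled bins (`idealTrace`). By `execSort_eq` the real run coincides with this unless there
is an overflow, in which case it aborts. As `S` always sorts, the output of the other runs is the
constant `sortedArray X`, so asking for joint distributions costs nothing.

The ideal access pattern has two symmetries. Reordering the keyed list changes nothing, since the
bins are shuffled (`idealTrace_perm`); and a strictly monotone relabelling changes nothing, since
`S` only compares (`idealTrace_map`). For distinct elements, sorting and relabelling turn `X` into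
`0, …, n - 1` without changing the distribution (`keyed_bind_idealTrace`). The ideal run on that
array is the simulator. Uniformity of the permutation is never needed separately.

Correctness and obliviousness thus both lose only the probability of overflow. Its bound is Markov's
inequality for `2 ^ N`, where `N` is the number of elements sent to one bucket: each of at most `2 ^
i * Z` candidates for a bucket of array `i + 1` matches with probability `2⁻⁽ⁱ⁺¹⁾`, so the moment is
at most `e^(Z/2)`, and dividing by `2 ^ (Z + 1)` leaves at most `e^(-Z/6) / 2`. The first level
cannot overflow, so the union bound has `(levels n Z - 1) * numBuckets n Z` terms, which minimality
of the number of buckets turns into `err n Z`.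

For ties, tagging makes the elements distinct, and dropping tags is post-processing that a
distinguisher could do itself. -/

theorem exists_perm_of_ofFn_perm {α : Type} {m : ℕ} {f g : Fin m → α}
    (h : (List.ofFn f).Perm (List.ofFn g)) : ∃ σ : Equiv.Perm (Fin m), ∀ i, g (σ i) = f i := by
  classical
  -- Each value has equally many preimages under `f` and `g`; bijections between the fibres glue to
  -- a permutation.
  have key : ∀ c, Nonempty ({i // f i = c} ≃ {i // g i = c}) := by
    intro c
    rw [← Fintype.card_eq]
    have e : ∀ f : Fin m → α, Fintype.card {i // f i = c} = (List.ofFn f).count c := by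
      intro f
      rw [← Multiset.coe_count, ← Fin.univ_val_map, Multiset.count_map, Fintype.card_subtype]
      simp only [eq_comm (a := c)]
      rfl
    rw [e, e, h.count_eq]
  exact ⟨Equiv.ofFiberEquiv fun c => (key c).some, fun i => Equiv.ofFiberEquiv_map _ i⟩

/-! ### Probability mass functions -/

namespace PMF

/-- The invariants below hold only for keyed lists of the right length with keys in range, hence the
restriction to the support. -/
theorem bind_congr_support {α β : Type} (p : PMF α) {f g : α → PMF β}
    (h : ∀ a ∈ p.support, f a = g a) : p.bind f = p.bind g := by
  ext b
  simp only [bind_apply]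
  refine tsum_congr fun a => ?_
  by_cases ha : p a = 0
  · simp [ha]
  · rw [h a ((mem_support_iff _ _).2 ha)]

theorem map_congr_support {α β : Type} (p : PMF α) {f g : α → β}
    (h : ∀ a ∈ p.support, f a = g a) : p.map f = p.map g :=
  bind_congr_support p fun a ha => by simp [h a ha]

theorem map_uniformOfFintype_equiv {α β : Type} [Fintype α] [Nonempty α] [Fintype β] [Nonempty β]
    (e : α ≃ β) : (uniformOfFintype α).map e = uniformOfFintype β := by
  classical
  ext b
  rw [map_apply, tsum_eq_single (e.symm b)]
  · simp [Fintype.card_congr e]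
  · intro a ha
    rw [if_neg]
    rintro rfl
    simp at ha

/-- Two experiments that agree outside an event. -/
theorem bind_apply_le_add {α β : Type} (p : PMF α) (f g : α → PMF β) (E : Set α)
    (h : ∀ a ∈ p.support, a ∉ E → f a = g a) (b : β) :
    p.bind f b ≤ p.bind g b + p.toOuterMeasure E := by
  classical
  rw [bind_apply, bind_apply, toOuterMeasure_apply, ← ENNReal.tsum_add]
  refine ENNReal.tsum_le_tsum fun a => ?_
  by_cases ha : a ∈ E
  · simp only [Set.indicator, ha, if_true]
    calc p a * f a b ≤ p a * 1 := by gcongr; exact coe_le_one _ _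
      _ ≤ _ := by simp
  · by_cases hs : p a = 0
    · simp [hs]
    · rw [h a ((mem_support_iff _ _).2 hs) ha]
      exact le_self_add

theorem toOuterMeasure_ne_top {α : Type} (p : PMF α) (E : Set α) : p.toOuterMeasure E ≠ ⊤ := by
  refine ne_top_of_le_ne_top ENNReal.one_ne_top ?_
  rw [toOuterMeasure_apply, ← p.tsum_coe]
  exact ENNReal.tsum_le_tsum fun a => Set.indicator_le_self _ _ a

theorem abs_bind_sub_bind_le {α β : Type} (p : PMF α) (f g : α → PMF β) (E : Set α)
    (h : ∀ a ∈ p.support, a ∉ E → f a = g a) (b : β) :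
    |(p.bind f b).toReal - (p.bind g b).toReal| ≤ (p.toOuterMeasure E).toReal := by
  have key : ∀ f g : α → PMF β, (∀ a ∈ p.support, a ∉ E → f a = g a) →
      (p.bind f b).toReal ≤ (p.bind g b).toReal + (p.toOuterMeasure E).toReal := by
    intro f g h
    rw [← ENNReal.toReal_add (apply_ne_top _ _) (toOuterMeasure_ne_top _ _)]
    exact ENNReal.toReal_mono
      (ENNReal.add_ne_top.2 ⟨apply_ne_top _ _, toOuterMeasure_ne_top _ _⟩)
      (bind_apply_le_add p f g E h b)
  rw [abs_le]
  constructor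
  · linarith [key g f fun a ha hE => (h a ha hE).symm]
  · linarith [key f g h]

end PMF

/-! ### Independent uniform keys -/

/-- Attach an independent uniformly random key in `{0, …, B - 1}` to every entry of a list. -/
noncomputable def keyed {α : Type} (B : ℕ) [NeZero B] : List α → PMF (List (α × ℕ))
  | [] => PMF.pure []
  | x :: xs => (PMF.uniformOfFintype (Fin B)).bind fun k =>
      (keyed B xs).bind fun cs => PMF.pure ((x, (k : ℕ)) :: cs)

section keyed

variable {α β : Type} {B : ℕ} [NeZero B]

theorem keyed_append (xs ys : List α) : keyed B (xs ++ ys) =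
    (keyed B xs).bind fun cs => (keyed B ys).bind fun ds => PMF.pure (cs ++ ds) := by
  induction xs with
  | nil => simp [keyed]
  | cons x xs ih => simp [keyed, ih]

theorem keyed_map (f : α → β) (xs : List α) :
    keyed B (xs.map f) = (keyed B xs).map (List.map (Prod.map f id)) := by
  induction xs with
  | nil => simp [keyed, PMF.pure_map]
  | cons x xs ih => simp [keyed, ih, PMF.map_bind, PMF.bind_map, PMF.pure_map, Function.comp_def]

theorem keyed_support {xs : List α} {cs : List (α × ℕ)} (h : cs ∈ (keyed B xs).support) :
    cs.map Prod.fst = xs ∧ ∀ c ∈ cs, c.2 < B := by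
  induction xs generalizing cs with
  | nil => simp_all [keyed]
  | cons x xs ih =>
    simp only [keyed, PMF.mem_support_bind_iff, PMF.mem_support_pure_iff] at h
    obtain ⟨k, -, ds, hds, rfl⟩ := h
    obtain ⟨h1, h2⟩ := ih hds
    simpa [h1] using h2

/-- An experiment that ignores the order of the keyed entries ignores the order of the input. -/
theorem keyed_bind_perm {xs ys : List α} (h : xs.Perm ys) (g : List (α × ℕ) → PMF β)
    (hg : ∀ cs ds, cs.Perm ds → g cs = g ds) : (keyed B xs).bind g = (keyed B ys).bind g := by
  induction h generalizing g with
  | nil => rfl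
  | cons x _ ih =>
    simp only [keyed, PMF.bind_bind, PMF.pure_bind]
    congr 1
    funext k
    exact ih _ fun cs ds hp => hg _ _ (hp.cons _)
  | swap x y l =>
    simp only [keyed, PMF.bind_bind, PMF.pure_bind]
    -- The two keys are independent, so they may be drawn in the opposite order.
    rw [PMF.bind_comm]
    congr 1; funext k; congr 1; funext k'; congr 1; funext cs
    exact hg _ _ (List.Perm.swap _ _ _)
  | trans _ _ ih₁ ih₂ => rw [ih₁ g hg, ih₂ g hg]

end keyed

/-! ### Uniform shuffles -/

/-- A uniformly random rearrangement of a list. -/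
noncomputable def shuf {α : Type} (l : List α) : PMF (List α) :=
  (PMF.uniformOfFintype (Equiv.Perm (Fin l.length))).map fun σ => List.ofFn fun i => l.get (σ i)

section shuf

variable {α β : Type}

theorem shuf_ofFn {m : ℕ} (f : Fin m → α) : shuf (List.ofFn f) =
    (PMF.uniformOfFintype (Equiv.Perm (Fin m))).map fun σ => List.ofFn fun i => f (σ i) := by
  -- The length is made a variable so that it can be substituted in the type of the permutation.
  have key : ∀ (l : List α) (hm : l.length = m), (∀ i, l.get i = f (Fin.cast hm i)) →
      shuf l = (PMF.uniformOfFintype (Equiv.Perm (Fin m))).map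
        fun σ => List.ofFn fun i => f (σ i) := by
    intro l hm h
    subst hm
    simp only [shuf, h]
    rfl
  exact key _ (List.length_ofFn) fun i => by rw [List.get_ofFn]

theorem shuf_map (f : α → β) (l : List α) : shuf (l.map f) = (shuf l).map (List.map f) := by
  conv_lhs => rw [← List.ofFn_get l, List.map_ofFn]
  rw [shuf_ofFn, shuf, PMF.map_comp]
  congr 1
  funext σ
  simp [List.map_ofFn, Function.comp_def]

theorem shuf_support {l l' : List α} (h : l' ∈ (shuf l).support) : l'.Perm l := by
  rw [shuf, PMF.mem_support_map_iff] at h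
  obtain ⟨σ, -, rfl⟩ := h
  conv_rhs => rw [← List.ofFn_get l]
  exact Equiv.Perm.ofFn_comp_perm σ l.get

/-- A rearrangement of the input by `τ` is absorbed by the uniform permutation: left multiplication
by `τ` preserves the uniform distribution. -/
theorem shuf_perm {l l' : List α} (h : l.Perm l') : shuf l = shuf l' := by
  obtain ⟨m, f, rfl⟩ : ∃ (m : ℕ) (f : Fin m → α), l = List.ofFn f := ⟨_, _, (List.ofFn_get l).symm⟩
  obtain ⟨g, rfl⟩ : ∃ g : Fin m → α, l' = List.ofFn g := by
    obtain ⟨k, g, rfl⟩ : ∃ (k : ℕ) (g : Fin k → α), l' = List.ofFn g :=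
      ⟨_, _, (List.ofFn_get l').symm⟩
    have := h.length_eq
    simp only [List.length_ofFn] at this
    subst this
    exact ⟨g, rfl⟩
  obtain ⟨τ, hτ⟩ := exists_perm_of_ofFn_perm h
  rw [shuf_ofFn, shuf_ofFn]
  conv_rhs => rw [← PMF.map_uniformOfFintype_equiv (Equiv.mulLeft τ), PMF.map_comp]
  congr 1
  funext σ
  simp [← hτ]

/-- Shuffle the first `J` of the given lists separately, and concatenate the results. -/
noncomputable def shufBins (bin : ℕ → List α) : ℕ → PMF (List α)
  | 0 => PMF.pure []
  | J + 1 => (shufBins bin J).bind fun acc => (shuf (bin J)).bind fun l => PMF.pure (acc ++ l)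

theorem shufBins_perm {bin bin' : ℕ → List α} (h : ∀ j, (bin j).Perm (bin' j)) (J : ℕ) :
    shufBins bin J = shufBins bin' J := by
  induction J with
  | zero => rfl
  | succ J ih => rw [shufBins, shufBins, ih, shuf_perm (h J)]

theorem shufBins_map (f : α → β) (bin : ℕ → List α) (J : ℕ) :
    shufBins (fun j => (bin j).map f) J = (shufBins bin J).map (List.map f) := by
  induction J with
  | zero => simp [shufBins, PMF.pure_map]
  | succ J ih =>
    simp only [shufBins, ih, shuf_map, PMF.bind_map, PMF.map_bind, PMF.pure_map, Function.comp_def,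
      List.map_append]

theorem shufBins_support {bin : ℕ → List α} {J : ℕ} {l : List α}
    (h : l ∈ (shufBins bin J).support) : l.Perm ((List.range J).flatMap bin) := by
  induction J generalizing l with
  | zero => simp_all [shufBins]
  | succ J ih =>
    simp only [shufBins, PMF.mem_support_bind_iff, PMF.mem_support_pure_iff] at h
    obtain ⟨acc, hacc, r, hr, rfl⟩ := h
    rw [List.range_succ, List.flatMap_append]
    simpa using (ih hacc).append (shuf_support hr)

end shuf

/-! ### Runs of client programs -/

namespace Client

variable {α β γ : Type}

/-- The joint distribution of the result and the final server state of a run from state `s`. -/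
noncomputable def eval (P : Client α β) (s : Server α) : PMF (Option β × Server α) :=
  StateT.run (OptionT.run P) s

theorem eval_pure (b : β) (s : Server α) :
    eval (pure b : Client α β) s = PMF.pure (some b, s) := rfl

theorem eval_bind (P : Client α β) (f : β → Client α γ) (s : Server α) :
    eval (P >>= f) s = (eval P s).bind fun r =>
      match r.1 with
      | none => PMF.pure (none, r.2)
      | some b => eval (f b) r.2 := by
  unfold eval
  simp only [OptionT.run_bind, Option.elimM, StateT.run_bind]
  change PMF.bind _ _ = _
  congr 1
  funext r
  rcases r with ⟨_ | b, s'⟩ <;> rfl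

theorem eval_bind_of_pure {P : Client α β} {s s' : Server α} {b : β}
    (h : eval P s = PMF.pure (some b, s')) (f : β → Client α γ) :
    eval (P >>= f) s = eval (f b) s' := by
  rw [eval_bind, h, PMF.pure_bind]

theorem eval_bind_of_none {P : Client α β} {s s' : Server α}
    (h : eval P s = PMF.pure (none, s')) (f : β → Client α γ) :
    eval (P >>= f) s = PMF.pure (none, s') := by
  rw [eval_bind, h, PMF.pure_bind]

/-- The normal form for a randomized phase that does not abort: draw `x`, after which result and
state are functions of `x`. This is what allows conditioning on the keys. -/
theorem eval_bind_of_bind {ι : Type} {P : Client α β} {s : Server α} {p : PMF ι} {v : ι → β}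
    {t : ι → Server α} (h : eval P s = p.bind fun x => PMF.pure (some (v x), t x))
    (f : β → Client α γ) : eval (P >>= f) s = p.bind fun x => eval (f (v x)) (t x) := by
  rw [eval_bind, h, PMF.bind_bind]
  simp

theorem eval_read (a : ℕ) (s : Server α) : eval (read a) s =
    PMF.pure (some (s.mem a), { s with trace := s.trace ++ [(.read, a)] }) :=
  PMF.pure_bind _ _

theorem eval_write (a : ℕ) (c : Cell α) (s : Server α) : eval (write a c) s =
    PMF.pure (some (), ⟨Function.update s.mem a c, s.trace ++ [(.write, a)]⟩) :=
  PMF.pure_bind _ _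

theorem eval_abort (s : Server α) : eval (abort : Client α β) s = PMF.pure (none, s) := rfl

theorem eval_sample (p : PMF β) (s : Server α) :
    eval (sample p : Client α β) s = p.bind fun b => PMF.pure (some b, s) := by
  change PMF.bind (PMF.bind p _) _ = _
  rw [PMF.bind_bind]
  congr 1
  funext b
  exact PMF.pure_bind _ _

theorem forM_range_succ (m : ℕ) (f : ℕ → Client α Unit) :
    (List.range (m + 1)).forM f = (List.range m).forM f >>= fun _ => f m := by
  simp only [List.forM_eq_forM, List.range_succ, List.forM_append, List.forM_cons, List.forM_nil]
  congr 1
  funext _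
  exact bind_pure (f m)

/-- The accesses made when `m` consecutive cells are accessed. -/
def accesses (k : AccessKind) (a m : ℕ) : List Access := (List.range m).map fun s => (k, a + s)

theorem eval_readList (a m : ℕ) (s : Server α) : eval (readList a m) s =
    PMF.pure (some ((List.range m).map fun i => s.mem (a + i)),
      { s with trace := s.trace ++ accesses .read a m }) := by
  have key : ∀ (l : List ℕ) (s : Server α), eval (l.mapM fun i => read (a + i)) s =
      PMF.pure (some (l.map fun i => s.mem (a + i)),
        { s with trace := s.trace ++ l.map fun i => (.read, a + i) }) := by
    intro l
    induction l with
    | nil => intro s; simp [eval_pure]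
    | cons i l ih =>
      intro s
      rw [List.mapM_cons, eval_bind_of_pure (eval_read _ _), eval_bind_of_pure (ih _), eval_pure]
      simp
  exact key _ s

/-- The memory after a write of the first `Z` entries of `l` (or dummies) from address `a` on. -/
def storeAt (Z a : ℕ) (l : List (Cell α)) (m : ℕ → Cell α) : ℕ → Cell α := fun x =>
  if a ≤ x ∧ x < a + Z then l.getD (x - a) Cell.dummy else m x

theorem storeAt_add {Z a : ℕ} (l : List (Cell α)) (m : ℕ → Cell α) {i : ℕ} (hi : i < Z) :
    storeAt Z a l m (a + i) = l.getD i Cell.dummy := by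
  simp [storeAt, hi]

theorem storeAt_of_lt {Z a x : ℕ} (l : List (Cell α)) (m : ℕ → Cell α) (h : x < a) :
    storeAt Z a l m x = m x := if_neg (by omega)

theorem storeAt_of_le {Z a x : ℕ} (l : List (Cell α)) (m : ℕ → Cell α) (h : a + Z ≤ x) :
    storeAt Z a l m x = m x := if_neg (by omega)

theorem eval_writeBucket (Z a : ℕ) (l : List (Cell α)) (s : Server α) :
    eval (writeBucket Z a l) s =
      PMF.pure (some (), ⟨storeAt Z a l s.mem, s.trace ++ accesses .write a Z⟩) := by
  unfold writeBucket
  induction Z with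
  | zero =>
    have : storeAt 0 a l s.mem = s.mem := by
      funext x
      exact if_neg (by omega)
    rw [this]
    simp [accesses, eval_pure]
  | succ Z ih =>
    rw [forM_range_succ, eval_bind_of_pure ih, eval_write]
    have : Function.update (storeAt Z a l s.mem) (a + Z) (l.getD Z Cell.dummy) =
        storeAt (Z + 1) a l s.mem := by
      funext x
      by_cases hx : x = a + Z
      · subst hx
        simp [storeAt]
      · rw [Function.update_of_ne hx]
        unfold storeAt
        congr 1
        apply propext
        omega
    rw [this, accesses, accesses, List.range_succ, List.map_append, List.append_assoc]
    rfl

theorem eval_writeList (a : ℕ) (l : List (Cell α)) (s : Server α) : eval (writeList a l) s =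
    PMF.pure (some (), ⟨storeAt l.length a l s.mem, s.trace ++ accesses .write a l.length⟩) :=
  eval_writeBucket l.length a l s

theorem eval_shuffle (l : List (Cell α)) (s : Server α) :
    eval (shuffle l) s = (shuf l).bind fun l' => PMF.pure (some l', s) := by
  unfold shuffle shuf
  rw [eval_bind_of_bind (eval_sample _ _), PMF.bind_map]
  rfl

theorem exec_eq {n : ℕ} (P : Client α Unit) (out : ℕ) (X : Fin n → α) : exec P out X =
    (eval P (init X)).map fun r => (r.2.trace, r.1.map fun _ (i : Fin n) => (r.2.mem (out + i)).val) := rfl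

end Client

/-! ### Semantics of comparison-based programs -/

/-- Apply a function to the element in a memory cell. -/
def Cell.map {α β : Type} (f : α → β) (c : Cell α) : Cell β := ⟨WithBot.map f c.val, c.key⟩

/-- Translate the address of an access. -/
def shiftAccess (base : ℕ) (x : Access) : Access := (x.1, base + x.2)

namespace CmpProg

/-- The memory that contains the given list and is blank otherwise. -/
def listMem {α : Type} (l : List α) (a : ℕ) : Cell α := (l[a]?).elim Cell.dummy fun x => ⟨(x : α), 0⟩

theorem init_mem {α : Type} {n : ℕ} (Y : Fin n → α) : (Client.init Y).mem = listMem (List.ofFn Y) := by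
  funext a
  unfold Client.init listMem
  by_cases h : a < n
  · simp [h]
  · simp [h]

variable {α β : Type} [LinearOrder α] [LinearOrder β]

/-- The accesses (with relative addresses) and the final memory of a run. -/
noncomputable def sem : CmpProg → (ℕ → Cell α) → (ℕ → Cell α) →
    PMF (List Access × (ℕ → Cell α))
  | .halt, _, m => PMF.pure ([], m)
  | .load r a next, reg, m =>
      (next.sem (Function.update reg r (m a)) m).map (Prod.map (List.cons (.read, a)) id)
  | .store r a next, reg, m =>
      (next.sem reg (Function.update m a (reg r))).map (Prod.map (List.cons (.write, a)) id)
  | .cmp r s next, reg, m => (next (decide ((reg r).val ≤ (reg s).val))).sem reg m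
  | .rand k next, reg, m =>
      (PMF.uniformOfFintype (Fin (k + 1))).bind fun i => (next i).sem reg m

/-- The server state after a run with the given accesses and the given final memory. -/
def finish (base : ℕ) (s : Server α) (r : List Access × (ℕ → Cell α)) : Server α where
  mem x := if base ≤ x then r.2 (x - base) else s.mem x
  trace := s.trace ++ r.1.map (shiftAccess base)

/-- All addresses are offset by `base`, so the cells below are untouched and the run is a translate
of one at address `0`. -/
theorem eval_run (S : CmpProg) (base : ℕ) (reg : ℕ → Cell α) (s : Server α) :
    Client.eval (S.run base reg) s = (S.sem reg fun x => s.mem (base + x)).map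
      fun r => (some (), finish base s r) := by
  induction S generalizing reg s with
  | halt =>
    rw [run, Client.eval_pure, sem, PMF.pure_map]
    have : finish base s ([], fun x => s.mem (base + x)) = s := by
      unfold finish
      cases s with
      | mk mem trace =>
        simp only [List.map_nil, List.append_nil, Server.mk.injEq, and_true]
        funext x
        split
        · congr 1; omega
        · rfl
    rw [this]
  | load r a next ih =>
    rw [run, Client.eval_bind_of_pure (Client.eval_read _ _), ih, sem, PMF.map_comp]
    congr 1
    funext r
    simp [finish, shiftAccess]
  | store r a next ih =>
    rw [run, Client.eval_bind_of_pure (Client.eval_write _ _ _), ih, sem, PMF.map_comp]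
    have : (fun x => Function.update s.mem (base + a) (reg r) (base + x)) =
        Function.update (fun x => s.mem (base + x)) a (reg r) := by
      funext x
      simp [Function.update_apply]
    simp only [this]
    congr 1
    funext q
    simp only [finish, Function.comp, Prod.map, shiftAccess, List.append_assoc, List.map_cons,
      id_eq, List.cons_append, List.nil_append, Prod.mk.injEq, true_and, Server.mk.injEq, and_true]
    funext x
    split
    · rfl
    · rw [Function.update_of_ne (by omega)]
  | cmp r s next ih => rw [run, ih, sem]
  | rand k next ih =>
    rw [run, Client.eval_bind_of_bind (Client.eval_sample _ _), sem, PMF.map_bind]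
    simp only [ih]

/-- Elements influence the control flow only through comparisons, which a strictly monotone map
preserves, also against the `⊥` of a blank cell. -/
theorem sem_map {f : α → β} (hf : StrictMono f) (S : CmpProg) (reg m : ℕ → Cell α) :
    S.sem (fun x => (reg x).map f) (fun x => (m x).map f) =
      (S.sem reg m).map (Prod.map id fun m x => (m x).map f) := by
  have upd : ∀ (g : ℕ → Cell α) (a : ℕ) (c : Cell α),
      Function.update (fun x => (g x).map f) a (c.map f) =
        fun x => (Function.update g a c x).map f := by
    intro g a c
    funext x
    simp only [Function.update_apply]
    split <;> rfl
  induction S generalizing reg m with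
  | halt => simp [sem, PMF.pure_map]
  | load r a next ih => simp only [sem, upd, ih, PMF.map_comp]; rfl
  | store r a next ih => simp only [sem, upd, ih, PMF.map_comp]; rfl
  | cmp r s next ih =>
    simp only [sem, ih]
    have : ((reg r).map f).val ≤ ((reg s).map f).val ↔ (reg r).val ≤ (reg s).val :=
      WithBot.map_le_iff f fun {a b} => hf.le_iff_le
    simp only [this]
  | rand k next ih => simp only [sem, ih, PMF.map_bind]

/-- The access pattern (with relative addresses) of a run on the given list. -/
noncomputable def accessPattern (S : CmpProg) (l : List α) : PMF (List Access) :=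
  (S.sem (fun _ => Cell.dummy) (listMem l)).map Prod.fst

theorem accessPattern_map {f : α → β} (hf : StrictMono f) (S : CmpProg) (l : List α) :
    S.accessPattern (l.map f) = S.accessPattern l := by
  have h1 : listMem (l.map f) = fun x => (listMem l x).map f := by
    funext x
    unfold listMem
    rw [List.getElem?_map]
    cases l[x]? <;> rfl
  have h2 : (fun _ : ℕ => (Cell.dummy : Cell β)) = fun x => (Cell.dummy : Cell α).map f := rfl
  rw [accessPattern, h1, h2, sem_map hf, PMF.map_comp]
  rfl

/-- `Sorts` speaks of base `0`, but `sem` uses relative addresses, so the conclusion also serves for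
runs at `outAddr`. -/
theorem Sorts.sem_val {S : CmpProg} {n : ℕ} (hS : S.Sorts n) (Y : Fin n → α)
    {r : List Access × (ℕ → Cell α)}
    (hr : r ∈ (S.sem (fun _ => Cell.dummy) (listMem (List.ofFn Y))).support) :
    (fun i : Fin n => (r.2 i).val) = sortedArray Y := by
  have := hS α Y ((finish 0 (Client.init Y) r).trace,
    some fun i => ((finish 0 (Client.init Y) r).mem (0 + i)).val) (by
      rw [Client.exec_eq, eval_run, PMF.map_comp, PMF.mem_support_map_iff]
      refine ⟨r, ?_, rfl⟩
      simpa [init_mem] using hr)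
  simpa [finish] using this

end CmpProg

theorem sortedArray_eq_of_perm {α : Type} [LinearOrder α] {n : ℕ} {X Y : Fin n → α}
    (h : (List.ofFn Y).Perm (List.ofFn X)) : sortedArray Y = sortedArray X := by
  obtain ⟨σ, hσ⟩ := exists_perm_of_ofFn_perm h
  obtain rfl : Y = X ∘ σ := funext fun i => (hσ i).symm
  have := Tuple.comp_perm_comp_sort_eq_comp_sort (f := X) (σ := σ)
  funext i
  exact congrArg _ (congrFun this i)

namespace Bucket

variable {α β : Type}

/-! ### The ideal experiment -/

/-- The elements with key `b`. -/
def bin (cs : List (α × ℕ)) (b : ℕ) : List α := (cs.filter fun c => c.2 = b).map Prod.fst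

/-- The first position of the `j`-th group. -/
def groupStart (n Z j : ℕ) : ℕ := j * n / numBuckets n Z

/-- The accesses of `distribute`, up to the `J`-th group. -/
def distributeTrace (n Z J : ℕ) : List Access := (List.range J).flatMap fun j =>
  Client.accesses .read (groupStart n Z j) (groupStart n Z (j + 1) - groupStart n Z j) ++
    Client.accesses .write (addr n Z 0 j) Z

/-- The accesses of a `mergeSplit` that does not abort. -/
def mergeSplitTrace (Z a₀ a₁ b₀ b₁ : ℕ) : List Access :=
  Client.accesses .read a₀ Z ++ Client.accesses .read a₁ Z ++
    (Client.accesses .write b₀ Z ++ Client.accesses .write b₁ Z)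

/-- The accesses of the `i`-th level of the network, up to the `J`-th `mergeSplit`. -/
def levelTrace (n Z i J : ℕ) : List Access := (List.range J).flatMap fun j =>
  mergeSplitTrace Z (addr n Z i (j / 2 ^ i * 2 ^ i + j)) (addr n Z i (j / 2 ^ i * 2 ^ i + j + 2 ^ i))
    (addr n Z (i + 1) (2 * j)) (addr n Z (i + 1) (2 * j + 1))

/-- The accesses of `binAssign`, up to the `I`-th level of the network. -/
def binAssignTrace (n Z I : ℕ) : List Access :=
  distributeTrace n Z (numBuckets n Z) ++
    (List.range I).flatMap fun i => levelTrace n Z i (numBuckets n Z / 2)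

/-- The accesses of the output phase, up to the `J`-th bin, for given loads of the bins. -/
def outputTrace (n Z : ℕ) (load : ℕ → ℕ) (J : ℕ) : List Access := (List.range J).flatMap fun j =>
  Client.accesses .read (addr n Z (levels n Z) j) Z ++
    Client.accesses .write (outAddr n Z + ((List.range j).map load).sum) (load j)

/-- The access pattern of bucket oblivious sort for given keys, in a network with large buckets. -/
noncomputable def idealTrace [LinearOrder α] (n Z : ℕ) (S : CmpProg) (cs : List (α × ℕ)) :
    PMF (List Access) :=
  (shufBins (bin cs) (numBuckets n Z)).bind fun l => (S.accessPattern l).map fun t =>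
    binAssignTrace n Z (levels n Z) ++
      outputTrace n Z (fun j => (bin cs j).length) (numBuckets n Z) ++
      t.map (shiftAccess (outAddr n Z))

theorem bin_perm {cs ds : List (α × ℕ)} (h : cs.Perm ds) (b : ℕ) : (bin cs b).Perm (bin ds b) :=
  (h.filter _).map _

theorem bin_map (f : α → β) (cs : List (α × ℕ)) (b : ℕ) :
    bin (cs.map (Prod.map f id)) b = (bin cs b).map f := by
  simp [bin, List.filter_map, Function.comp_def]

theorem idealTrace_perm [LinearOrder α] (n Z : ℕ) (S : CmpProg) {cs ds : List (α × ℕ)}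
    (h : cs.Perm ds) : idealTrace n Z S cs = idealTrace n Z S ds := by
  unfold idealTrace
  rw [shufBins_perm (bin_perm h)]
  simp only [(bin_perm h _).length_eq]

theorem idealTrace_map [LinearOrder α] [LinearOrder β] {f : α → β} (hf : StrictMono f) (n Z : ℕ)
    (S : CmpProg) (cs : List (α × ℕ)) :
    idealTrace n Z S (cs.map (Prod.map f id)) = idealTrace n Z S cs := by
  have : bin (cs.map (Prod.map f id)) = fun b => (bin cs b).map f := funext (bin_map f cs)
  unfold idealTrace
  rw [this, shufBins_map, PMF.bind_map]
  simp only [Function.comp_def, S.accessPattern_map hf, List.length_map]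

/-- The simulated access pattern. -/
noncomputable def simulator (n Z : ℕ) (S : CmpProg) : PMF (List Access) :=
  (keyed (numBuckets n Z) (List.finRange n)).bind (idealTrace n Z S)

theorem keyed_bind_idealTrace [LinearOrder α] {n : ℕ} (Z : ℕ) (S : CmpProg) {X : Fin n → α}
    (hX : Function.Injective X) :
    (keyed (numBuckets n Z) (List.ofFn X)).bind (idealTrace n Z S) = simulator n Z S := by
  set e : Fin n → α := X ∘ Tuple.sort X
  have he : StrictMono e :=
    (Tuple.monotone_sort X).strictMono_of_injective (hX.comp (Tuple.sort X).injective)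
  -- First symmetry: pass to the sorted array `e`. Injectivity of `X` makes `e` strictly monotone,
  -- so the second symmetry then replaces it by `List.finRange n`.
  rw [keyed_bind_perm (Equiv.Perm.ofFn_comp_perm (Tuple.sort X) X).symm _
    fun _ _ => idealTrace_perm n Z S]
  change (keyed _ (List.ofFn e)).bind _ = _
  have : List.ofFn e = (List.finRange n).map e := List.ofFn_eq_map
  rw [this, keyed_map, PMF.bind_map, simulator]
  congr 1
  funext cs
  exact idealTrace_map he n Z S cs

/-! ### The contents of the buckets -/

/-- The entries at the positions from `a` up to `b`. -/
def slice (a b : ℕ) (cs : List α) : List α := (cs.drop a).take (b - a)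

theorem slice_append_slice {a b c : ℕ} (hab : a ≤ b) (hbc : b ≤ c) (cs : List α) :
    slice a b cs ++ slice b c cs = slice a c cs := by
  unfold slice
  obtain ⟨d, rfl⟩ := Nat.exists_eq_add_of_le hab
  obtain ⟨e, rfl⟩ := Nat.exists_eq_add_of_le hbc
  rw [show a + d + e - a = d + e by omega, List.take_add, List.drop_drop]
  simp

theorem length_slice_le (a b : ℕ) (cs : List α) : (slice a b cs).length ≤ b - a := by
  simp [slice]

/-- What the `b`-th bucket of the `i`-th array contains when no bucket overflows. -/
def content (n Z i b : ℕ) (cs : List (α × ℕ)) : List (α × ℕ) :=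
  (slice (groupStart n Z (b / 2 ^ i * 2 ^ i)) (groupStart n Z ((b / 2 ^ i + 1) * 2 ^ i)) cs).filter
    fun c => c.2 / 2 ^ (levels n Z - i) = b % 2 ^ i

theorem content_zero {n Z b : ℕ} {cs : List (α × ℕ)} (hcs : ∀ c ∈ cs, c.2 < numBuckets n Z) :
    content n Z 0 b cs = slice (groupStart n Z b) (groupStart n Z (b + 1)) cs := by
  simp only [content, pow_zero, Nat.div_one, mul_one, Nat.mod_one, Nat.sub_zero]
  rw [List.filter_eq_self]
  intro c hc
  have : c ∈ cs := List.mem_of_mem_drop (List.mem_of_mem_take hc)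
  -- At level `0` the condition reads `key / 2 ^ L = 0`, which all keys below `2 ^ L` satisfy.
  exact decide_eq_true (Nat.div_eq_of_lt (hcs c this))

theorem groupStart_numBuckets (n Z : ℕ) : groupStart n Z (numBuckets n Z) = n :=
  Nat.mul_div_cancel_left _ (Nat.pos_of_neZero _)

theorem groupStart_mono (n Z : ℕ) : Monotone (groupStart n Z) := fun _ _ h =>
  Nat.div_le_div_right (Nat.mul_le_mul_right _ h)

theorem content_levels {n Z b : ℕ} (hb : b < numBuckets n Z) {cs : List (α × ℕ)}
    (hcs : cs.length = n) : content n Z (levels n Z) b cs = cs.filter fun c => c.2 = b := by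
  have h1 : b / 2 ^ levels n Z = 0 := Nat.div_eq_of_lt hb
  have h2 : b % 2 ^ levels n Z = b := Nat.mod_eq_of_lt hb
  have h3 : groupStart n Z (2 ^ levels n Z) = n := groupStart_numBuckets n Z
  have h4 : groupStart n Z 0 = 0 := by simp [groupStart]
  simp only [content, h1, h2, h3, h4, slice, zero_mul, zero_add, one_mul, Nat.sub_self, pow_zero,
    Nat.div_one, List.drop_zero, Nat.sub_zero]
  rw [List.take_of_length_le hcs.le]

/-- Write `j = q * 2 ^ i + r` with `r < 2 ^ i`. The sources are the buckets with key prefix `r` of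
the adjacent blocks `2 * q` and `2 * q + 1`; the target belongs to their union, block `q` of twice
the size, and its prefix `2 * r + v` is `r` extended by the bit `v`. -/
theorem content_succ {n Z i j : ℕ} (hi : i < levels n Z) (cs : List (α × ℕ)) (v : Bool) :
    content n Z (i + 1) (2 * j + v.toNat) cs =
      (content n Z i (j / 2 ^ i * 2 ^ i + j) cs ++
        content n Z i (j / 2 ^ i * 2 ^ i + j + 2 ^ i) cs).filter
          fun c => c.2.testBit (levels n Z - 1 - i) == v := by
  have hp : 0 < 2 ^ i := by positivity
  set w := 2 ^ i with hw
  obtain ⟨q, r, hr, rfl⟩ : ∃ q r, r < w ∧ j = q * w + r :=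
    ⟨j / w, j % w, Nat.mod_lt _ hp, (Nat.div_add_mod' j w).symm⟩
  have hv : v.toNat < 2 := by cases v <;> simp
  have d0 : (q * w + r) / w = q := by
    rw [mul_comm, Nat.mul_add_div hp, Nat.div_eq_of_lt hr, add_zero]
  have e1 : q * w + (q * w + r) = (2 * q) * w + r := by ring
  have e2 : q * w + (q * w + r) + w = (2 * q + 1) * w + r := by ring
  have e3 : 2 * (q * w + r) + v.toNat = q * (2 * w) + (2 * r + v.toNat) := by ring
  have dv : ∀ q w r : ℕ, r < w → (q * w + r) / w = q ∧ (q * w + r) % w = r := by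
    intro q w r h
    constructor
    · rw [mul_comm, Nat.mul_add_div (by omega), Nat.div_eq_of_lt h, add_zero]
    · rw [mul_comm, Nat.mul_add_mod, Nat.mod_eq_of_lt h]
  have hw' : 2 ^ (i + 1) = 2 * w := by rw [pow_succ, hw]; ring
  unfold content
  rw [d0, e2, e1, e3, hw', ← hw, (dv _ _ _ hr).1, (dv _ _ _ hr).1, (dv _ _ _ hr).2, (dv _ _ _ hr).2,
    (dv q (2 * w) (2 * r + v.toNat) (by omega)).1, (dv q (2 * w) (2 * r + v.toNat) (by omega)).2,
    ← List.filter_append, slice_append_slice (groupStart_mono _ _ (by gcongr; omega))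
      (groupStart_mono _ _ (by gcongr; omega)), List.filter_filter]
  rw [show q * (2 * w) = 2 * q * w by ring, show (q + 1) * (2 * w) = (2 * q + 1 + 1) * w by ring]
  congr 1
  funext c
  obtain ⟨m, hm⟩ : ∃ m, levels n Z = m + 1 + i := ⟨levels n Z - 1 - i, by omega⟩
  rw [show levels n Z - (i + 1) = m by omega, show levels n Z - 1 - i = m by omega,
    show levels n Z - i = m + 1 by omega, Nat.testBit_eq_decide_div_mod_eq, pow_succ,
    ← Nat.div_div_eq_div_mul, Bool.eq_iff_iff]
  cases v <;> simp only [Bool.toNat_false, Bool.toNat_true, Bool.and_eq_true,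
    beq_iff_eq, decide_eq_true_eq, decide_eq_false_iff_not] <;> omega

/-! ### Sizes of groups and of blocks of groups -/

theorem two_mul_le_numBuckets_mul {Z : ℕ} (hZ : 0 < Z) (n : ℕ) : 2 * n ≤ numBuckets n Z * Z := by
  have h : (2 * n) ⌈/⌉ Z ≤ numBuckets n Z := Nat.le_pow_clog one_lt_two _
  rw [ceilDiv_le_iff_le_mul hZ] at h
  linarith

theorem groupStart_sub_le {n Z w M : ℕ} (h : w * n ≤ M * numBuckets n Z) (a : ℕ) :
    groupStart n Z (a + w) - groupStart n Z a ≤ M := by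
  rw [Nat.sub_le_iff_le_add']
  unfold groupStart
  rw [← Nat.add_mul_div_right _ _ (Nat.pos_of_neZero _), add_mul]
  exact Nat.div_le_div_right (by omega)

theorem group_le {Z : ℕ} (hZ : 0 < Z) (n a : ℕ) :
    groupStart n Z (a + 1) - groupStart n Z a ≤ Z :=
  groupStart_sub_le (by have := two_mul_le_numBuckets_mul hZ n; rw [mul_comm Z]; omega) a

theorem block_le {Z : ℕ} (hZ : 0 < Z) (n i b : ℕ) :
    groupStart n Z ((b / 2 ^ (i + 1) + 1) * 2 ^ (i + 1)) -
      groupStart n Z (b / 2 ^ (i + 1) * 2 ^ (i + 1)) ≤ 2 ^ i * Z := by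
  rw [add_mul, one_mul]
  refine groupStart_sub_le ?_ _
  have := two_mul_le_numBuckets_mul hZ n
  rw [pow_succ, mul_assoc, mul_assoc, mul_comm Z]
  exact Nat.mul_le_mul_left _ this

end Bucket

/-! ### The probability of an overflow -/

section tail

variable {α β : Type}

open scoped ENNReal

theorem PMF.tsum_bind_mul (p : PMF α) (g : α → PMF β) (f : β → ℝ≥0∞) :
    ∑' b, p.bind g b * f b = ∑' a, p a * ∑' b, g a b * f b := by
  simp only [PMF.bind_apply, ← ENNReal.tsum_mul_right, ← ENNReal.tsum_mul_left, mul_assoc]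
  exact ENNReal.tsum_comm

theorem PMF.tsum_pure_mul (a : α) (f : α → ℝ≥0∞) : ∑' b, PMF.pure a b * f b = f a := by
  classical
  rw [tsum_eq_single a fun b hb => by simp [PMF.pure_apply, hb]]
  simp

/-- Markov's inequality for the moment `2 ^ N` of a counting variable `N`. -/
theorem PMF.toOuterMeasure_lt_le (p : PMF α) (N : α → ℕ) (Z : ℕ) :
    p.toOuterMeasure {a | Z < N a} ≤ (∑' a, p a * 2 ^ N a) / 2 ^ (Z + 1) := by
  classical
  rw [ENNReal.le_div_iff_mul_le (by simp) (by simp), PMF.toOuterMeasure_apply,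
    ← ENNReal.tsum_mul_right]
  refine ENNReal.tsum_le_tsum fun a => ?_
  by_cases h : Z < N a
  · simp only [Set.indicator, Set.mem_ofPred_eq, h, if_true]
    gcongr
    · exact one_le_two
    · exact h
  · simp [Set.indicator, h]

variable {B : ℕ} [NeZero B]

/-- The moment of the number of entries whose key has the property `P`. -/
theorem keyed_moment_le (P : ℕ → Bool) {q : ℝ≥0∞}
    (hq : ∑ k : Fin B, (B : ℝ≥0∞)⁻¹ * (if P k then 2 else 1) ≤ q) (xs : List α) :
    ∑' cs, keyed B xs cs * 2 ^ (cs.filter fun c => P c.2).length ≤ q ^ xs.length := by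
  induction xs with
  | nil => simp [keyed]
  | cons x xs ih =>
    simp only [keyed, PMF.tsum_bind_mul, PMF.tsum_pure_mul]
    have : ∀ (k : Fin B) (cs : List (α × ℕ)),
        (2 : ℝ≥0∞) ^ (((x, (k : ℕ)) :: cs).filter fun c => P c.2).length =
          (if P k then 2 else 1) * 2 ^ (cs.filter fun c => P c.2).length := by
      intro k cs
      by_cases h : P k = true
      · simp [h, pow_succ, mul_comm]
      · simp [h]
    simp only [this, mul_left_comm (keyed B xs _), ENNReal.tsum_mul_left]
    rw [tsum_fintype]
    simp only [← mul_assoc]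
    rw [← Finset.sum_mul, List.length_cons, pow_succ']
    gcongr
    simpa using hq

/-- Keys are independent, so the unused ones integrate out: any segment of a keyed list is again a
keyed list. -/
theorem keyed_map_take (xs : List α) (a : ℕ) :
    (keyed B xs).map (List.take a) = keyed B (xs.take a) := by
  induction xs generalizing a with
  | nil => simp [keyed, PMF.pure_map]
  | cons x xs ih =>
    cases a with
    | zero =>
      have : List.take 0 = Function.const (List (α × ℕ)) [] := by funext l; simp
      rw [this, PMF.map_const]
      rfl
    | succ a => simp [keyed, ← ih, PMF.map_bind, PMF.pure_map, PMF.bind_map, Function.comp_def]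

theorem keyed_map_drop (xs : List α) (a : ℕ) :
    (keyed B xs).map (List.drop a) = keyed B (xs.drop a) := by
  induction xs generalizing a with
  | nil => simp [keyed, PMF.pure_map]
  | cons x xs ih =>
    cases a with
    | zero =>
      have : List.drop 0 = @id (List (α × ℕ)) := by funext l; simp
      rw [this, PMF.map_id]
      rfl
    | succ a =>
      rw [List.drop_succ_cons, ← ih]
      simp only [keyed, PMF.map_bind, PMF.pure_map, List.drop_succ_cons, PMF.bind_const]
      rfl

end tail

namespace Bucket

open scoped ENNReal

variable {α : Type}

/-! ### Tail bound for one bucket, and the union bound -/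

theorem keyed_map_slice {B : ℕ} [NeZero B] (xs : List α) (a b : ℕ) :
    (keyed B xs).map (slice a b) = keyed B (slice a b xs) := by
  unfold slice
  rw [← keyed_map_take, ← keyed_map_drop, PMF.map_comp]
  rfl

theorem card_key_div_eq_le {B m : ℕ} (r : ℕ) :
    (Finset.univ.filter fun k : Fin B => (k : ℕ) / 2 ^ m = r).card ≤ 2 ^ m := by
  have hp : 0 < 2 ^ m := by positivity
  calc _ = ((Finset.univ.filter fun k : Fin B => (k : ℕ) / 2 ^ m = r).map Fin.valEmbedding).card :=
        (Finset.card_map _).symm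
    _ ≤ (Finset.Ico (r * 2 ^ m) (r * 2 ^ m + 2 ^ m)).card := by
        apply Finset.card_le_card
        intro k hk
        simp only [Finset.mem_map, Finset.mem_filter, Finset.mem_univ, true_and,
          Fin.valEmbedding_apply] at hk
        obtain ⟨k, rfl, rfl⟩ := hk
        have h1 := Nat.div_add_mod' (k : ℕ) (2 ^ m)
        have h2 := Nat.mod_lt (k : ℕ) hp
        simp only [Finset.mem_Ico]
        omega
    _ = 2 ^ m := by simp

/-- The moment of one key: its leading `i` bits have a given value with probability `2⁻ⁱ`. -/
theorem sum_key_le {n Z i : ℕ} (hi : i ≤ levels n Z) (r : ℕ) :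
    ∑ k : Fin (numBuckets n Z), (numBuckets n Z : ℝ≥0∞)⁻¹ *
      (if decide ((k : ℕ) / 2 ^ (levels n Z - i) = r) then 2 else 1) ≤
        ENNReal.ofReal (1 + (2 ^ i)⁻¹) := by
  set B := numBuckets n Z with hB
  have hB0 : (0 : ℝ) < B := by exact_mod_cast Nat.pos_of_neZero B
  have hsum : ∑ k : Fin B, (if decide ((k : ℕ) / 2 ^ (levels n Z - i) = r) then (2 : ℝ) else 1) =
      B + (Finset.univ.filter fun k : Fin B => (k : ℕ) / 2 ^ (levels n Z - i) = r).card := by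
    have : ∀ k : Fin B, (if decide ((k : ℕ) / 2 ^ (levels n Z - i) = r) then (2 : ℝ) else 1) =
        1 + if (k : ℕ) / 2 ^ (levels n Z - i) = r then 1 else 0 := by
      intro k
      by_cases h : (k : ℕ) / 2 ^ (levels n Z - i) = r
      · simp only [h, decide_true, if_true]; norm_num
      · simp [h]
    simp only [this, Finset.sum_add_distrib, Finset.sum_boole]
    simp
  have hle : ((Finset.univ.filter fun k : Fin B => (k : ℕ) / 2 ^ (levels n Z - i) = r).card : ℝ) ≤
      B * (2 ^ i)⁻¹ := by
    calc _ ≤ ((2 ^ (levels n Z - i) : ℕ) : ℝ) := by exact_mod_cast card_key_div_eq_le r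
      _ = _ := by
        rw [hB, numBuckets]
        push_cast
        rw [pow_sub₀ _ two_ne_zero hi]
  calc _ = ENNReal.ofReal (∑ k : Fin B, (B : ℝ)⁻¹ *
        (if decide ((k : ℕ) / 2 ^ (levels n Z - i) = r) then 2 else 1)) := by
        rw [ENNReal.ofReal_sum_of_nonneg fun k _ => by positivity]
        refine Finset.sum_congr rfl fun k _ => ?_
        rw [ENNReal.ofReal_mul (by positivity), ENNReal.ofReal_inv_of_pos hB0,
          ENNReal.ofReal_natCast]
        congr 1
        split <;> simp
    _ ≤ _ := by
        apply ENNReal.ofReal_le_ofReal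
        rw [← Finset.mul_sum, hsum, mul_add, inv_mul_cancel₀ hB0.ne']
        gcongr
        rw [inv_mul_le_iff₀ hB0]
        exact hle

/-- Since `log 2 ≥ 2/3`, one has `2 ^ Z ≥ e^(2Z/3)`, and `1/2 - 2/3 = -1/6`. The factor `1/2` comes
from the strict inequality `Z < N`, that is, `Z + 1 ≤ N`. -/
theorem exp_div_le (Z : ℕ) :
    Real.exp (Z / 2) / 2 ^ (Z + 1) ≤ Real.exp (-Z / 6) / 2 := by
  have h2 : Real.exp (2 * Z / 3) ≤ 2 ^ Z := by
    have : (2 : ℝ) ^ Z = Real.exp (Z * Real.log 2) := by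
      rw [mul_comm, Real.exp_mul, Real.exp_log two_pos, Real.rpow_natCast]
    rw [this, Real.exp_le_exp]
    have := Real.log_two_gt_d9
    have : (2 : ℝ) / 3 ≤ Real.log 2 := by linarith
    nlinarith [Nat.cast_nonneg (α := ℝ) Z]
  rw [div_le_div_iff₀ (by positivity) two_pos, pow_succ, ← mul_assoc]
  gcongr
  calc Real.exp (Z / 2) = Real.exp (-Z / 6) * Real.exp (2 * Z / 3) := by
        rw [← Real.exp_add]; congr 1; ring
    _ ≤ _ := by gcongr

theorem content_tail_le {Z : ℕ} (hZ : 0 < Z) {n i : ℕ} (hi : i < levels n Z) (b : ℕ)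
    (xs : List α) : (keyed (numBuckets n Z) xs).toOuterMeasure
      {cs | Z < (content n Z (i + 1) b cs).length} ≤ ENNReal.ofReal (Real.exp (-Z / 6) / 2) := by
  set a := groupStart n Z (b / 2 ^ (i + 1) * 2 ^ (i + 1))
  set a' := groupStart n Z ((b / 2 ^ (i + 1) + 1) * 2 ^ (i + 1))
  set P : ℕ → Bool := fun k => decide (k / 2 ^ (levels n Z - (i + 1)) = b % 2 ^ (i + 1))
  have hset : {cs : List (α × ℕ) | Z < (content n Z (i + 1) b cs).length} =
      slice a a' ⁻¹' {ds | Z < (ds.filter fun c => P c.2).length} := rfl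
  have hlen : (slice a a' xs).length ≤ 2 ^ i * Z :=
    (length_slice_le _ _ _).trans (block_le hZ n i b)
  rw [hset, ← PMF.toOuterMeasure_map_apply, keyed_map_slice]
  refine (PMF.toOuterMeasure_lt_le _ _ _).trans ?_
  have h1 : (1 : ℝ) ≤ 1 + (2 ^ (i + 1))⁻¹ := le_add_of_nonneg_right (by positivity)
  calc _ ≤ ENNReal.ofReal (1 + (2 ^ (i + 1))⁻¹) ^ (slice a a' xs).length / 2 ^ (Z + 1) := by
        gcongr
        exact keyed_moment_le P (sum_key_le hi _) _
    _ ≤ ENNReal.ofReal (1 + (2 ^ (i + 1))⁻¹) ^ (2 ^ i * Z) / 2 ^ (Z + 1) := by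
        gcongr
        simp
    _ = ENNReal.ofReal ((1 + (2 ^ (i + 1))⁻¹) ^ (2 ^ i * Z) / 2 ^ (Z + 1)) := by
        rw [ENNReal.ofReal_div_of_pos (by positivity), ENNReal.ofReal_pow (by positivity),
          ENNReal.ofReal_pow (by positivity), ENNReal.ofReal_ofNat]
    _ ≤ _ := by
        apply ENNReal.ofReal_le_ofReal
        refine le_trans ?_ (exp_div_le Z)
        gcongr
        calc (1 + ((2 : ℝ) ^ (i + 1))⁻¹) ^ (2 ^ i * Z)
            ≤ Real.exp ((2 ^ (i + 1))⁻¹) ^ (2 ^ i * Z) := by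
              gcongr
              rw [add_comm]
              exact Real.add_one_le_exp _
          _ = Real.exp (Z / 2) := by
              rw [← Real.exp_nat_mul]
              congr 1
              push_cast
              rw [pow_succ]
              field_simp

/-- Some bucket of the network would receive more than `Z` elements. -/
def Overflow (n Z : ℕ) (cs : List (α × ℕ)) : Prop :=
  ∃ i < levels n Z, ∃ b < numBuckets n Z, Z < (content n Z (i + 1) b cs).length

theorem overflow_le_union {Z : ℕ} (hZ : 0 < Z) (n : ℕ) (xs : List α) :
    (keyed (numBuckets n Z) xs).toOuterMeasure {cs | Overflow n Z cs} ≤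
      ((levels n Z - 1 : ℕ) : ℝ≥0∞) *
        (numBuckets n Z * ENNReal.ofReal (Real.exp (-Z / 6) / 2)) := by
  set μ := (keyed (numBuckets n Z) xs).toOuterMeasure
  have hsub : {cs : List (α × ℕ) | Overflow n Z cs} ⊆
      ⋃ i ∈ Finset.Ico 1 (levels n Z), ⋃ b ∈ Finset.range (numBuckets n Z),
        {cs | Z < (content n Z (i + 1) b cs).length} := by
    rintro cs ⟨i, hi, b, hb, h⟩
    simp only [Set.mem_iUnion, Finset.mem_Ico, Finset.mem_range]
    refine ⟨i, ⟨?_, hi⟩, b, hb, h⟩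
    rcases Nat.eq_zero_or_pos i with rfl | h0
    -- Two groups together have at most `Z` elements, so the first level never overflows.
    · have h1 : (content n Z (0 + 1) b cs).length ≤ Z :=
        (List.length_filter_le _ _).trans
          ((length_slice_le _ _ _).trans ((block_le hZ n 0 b).trans (by simp)))
      exact absurd h h1.not_gt
    · exact h0
  calc _ ≤ _ := μ.mono hsub
    _ ≤ ∑ i ∈ Finset.Ico 1 (levels n Z), ∑ b ∈ Finset.range (numBuckets n Z),
        μ {cs | Z < (content n Z (i + 1) b cs).length} :=
      (MeasureTheory.measure_biUnion_finset_le _ _).trans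
        (Finset.sum_le_sum fun i _ => MeasureTheory.measure_biUnion_finset_le _ _)
    _ ≤ ∑ i ∈ Finset.Ico 1 (levels n Z), ∑ b ∈ Finset.range (numBuckets n Z),
        ENNReal.ofReal (Real.exp (-Z / 6) / 2) :=
      Finset.sum_le_sum fun i hi => Finset.sum_le_sum fun b _ =>
        content_tail_le hZ (Finset.mem_Ico.1 hi).2 b xs
    _ = _ := by simp

theorem union_le_err {Z : ℕ} (hZ : 0 < Z) (n : ℕ) :
    ((levels n Z - 1 : ℕ) : ℝ) * (numBuckets n Z * (Real.exp (-Z / 6) / 2)) ≤ err n Z := by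
  have hZ' : (0 : ℝ) < Z := by exact_mod_cast hZ
  unfold err
  rcases Nat.lt_or_ge 1 (levels n Z) with h | h
  · obtain ⟨l, hl⟩ : ∃ l, levels n Z = l + 1 := ⟨levels n Z - 1, by omega⟩
    -- By minimality of `levels`, half the number of buckets is still below `2n/Z`; this bounds both
    -- `numBuckets / 2` and, after taking logarithms, `levels - 1`.
    have hx : (2 : ℝ) ^ l ≤ 2 * n / Z := by
      have h1 : 2 ^ l < (2 * n) ⌈/⌉ Z :=
        (Nat.lt_clog_iff_pow_lt one_lt_two).1 (show l < levels n Z by omega)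
      have h2 : Z * 2 ^ l < 2 * n := by
        by_contra! h3
        exact absurd ((ceilDiv_le_iff_le_mul hZ).2 h3) (by omega)
      rw [le_div_iff₀ hZ']
      exact_mod_cast (by rw [mul_comm]; exact h2.le : 2 ^ l * Z ≤ 2 * n)
    have hlog : (l : ℝ) ≤ max 0 (Real.logb 2 (2 * n / Z)) := by
      apply le_max_of_le_right
      rw [Real.le_logb_iff_rpow_le one_lt_two (lt_of_lt_of_le (by positivity) hx)]
      simpa using hx
    rw [numBuckets, hl]
    push_cast
    calc (((l + 1 - 1 : ℕ)) : ℝ) * (2 ^ (l + 1) * (Real.exp (-Z / 6) / 2))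
        = 2 ^ l * l * Real.exp (-Z / 6) := by rw [Nat.add_sub_cancel, pow_succ]; ring
      _ ≤ _ := by gcongr
  · rw [Nat.sub_eq_zero_of_le h]
    simp only [Nat.cast_zero, zero_mul]
    positivity

theorem overflow_le_err {Z : ℕ} (hZ : 0 < Z) (n : ℕ) (xs : List α) :
    ((keyed (numBuckets n Z) xs).toOuterMeasure {cs | Overflow n Z cs}).toReal ≤ err n Z := by
  refine le_trans ?_ (union_le_err hZ n)
  have := ENNReal.toReal_mono (ENNReal.mul_ne_top (ENNReal.natCast_ne_top _)
    (ENNReal.mul_ne_top (ENNReal.natCast_ne_top _) ENNReal.ofReal_ne_top))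
    (overflow_le_union hZ n xs)
  refine this.trans_eq ?_
  rw [ENNReal.toReal_mul, ENNReal.toReal_mul, ENNReal.toReal_natCast, ENNReal.toReal_natCast,
    ENNReal.toReal_ofReal (by positivity)]

end Bucket

namespace Bucket

variable {α : Type}

/-! ### Contents of the memory -/

/-- The memory cell for an element with a key. -/
def toCell (c : α × ℕ) : Cell α := ⟨(c.1 : α), c.2⟩

/-- The bucket at address `a` contains exactly the entries of `l`, followed by dummies. -/
def Holds (Z : ℕ) (m : ℕ → Cell α) (a : ℕ) (l : List (α × ℕ)) : Prop :=
  l.length ≤ Z ∧ ∀ s < Z, m (a + s) = (l.map toCell).getD s Cell.dummy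

theorem Holds.congr {Z : ℕ} {m m' : ℕ → Cell α} {a : ℕ} {l : List (α × ℕ)} (h : Holds Z m a l)
    (hm : ∀ s < Z, m' (a + s) = m (a + s)) : Holds Z m' a l :=
  ⟨h.1, fun s hs => (hm s hs).trans (h.2 s hs)⟩

theorem holds_storeAt {Z : ℕ} (m : ℕ → Cell α) (a : ℕ) {l : List (α × ℕ)} (hl : l.length ≤ Z) :
    Holds Z (Client.storeAt Z a (l.map toCell) m) a l :=
  ⟨hl, fun _ hs => Client.storeAt_add _ _ hs⟩

theorem Holds.storeAt_of_disjoint {Z : ℕ} {m : ℕ → Cell α} {a : ℕ} {l : List (α × ℕ)}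
    (h : Holds Z m a l) {b : ℕ} (hab : a + Z ≤ b ∨ b + Z ≤ a) (l' : List (Cell α)) :
    Holds Z (Client.storeAt Z b l' m) a l := by
  refine h.congr fun s hs => ?_
  rcases hab with hab | hab
  · exact Client.storeAt_of_lt _ _ (by omega)
  · exact Client.storeAt_of_le _ _ (by omega)

/-- Beyond `l` the bucket contains only padding, so discarding dummies recovers `l` in order. -/
theorem Holds.filter_isReal {Z : ℕ} {m : ℕ → Cell α} {a : ℕ} {l : List (α × ℕ)}
    (h : Holds Z m a l) :
    ((List.range Z).map fun s => m (a + s)).filter Cell.isReal = l.map toCell := by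
  have : ((List.range Z).map fun s => m (a + s)) =
      l.map toCell ++ List.replicate (Z - l.length) Cell.dummy := by
    apply List.ext_getElem
    · simp; have := h.1; omega
    · intro s h1 h2
      simp only [List.length_map, List.length_range] at h1
      rw [List.getElem_map, List.getElem_range, h.2 s h1, List.getElem_append]
      by_cases hs : s < l.length <;> simp [hs]
  rw [this, List.filter_append]
  have h1 : (l.map toCell).filter Cell.isReal = l.map toCell := by
    rw [List.filter_eq_self]
    simp only [List.mem_map]
    rintro _ ⟨c, -, rfl⟩
    rfl
  have h2 : (List.replicate (Z - l.length) (Cell.dummy : Cell α)).filter Cell.isReal = [] := by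
    rw [List.filter_eq_nil_iff]
    intro c hc
    rw [List.eq_of_mem_replicate hc]
    simp [Cell.isReal, Cell.dummy]
  rw [h1, h2, List.append_nil]

/-! ### Disjointness of the memory regions -/

theorem addr_add_le {n Z i j i' j' : ℕ}
    (h : i * numBuckets n Z + j + 1 ≤ i' * numBuckets n Z + j') :
    addr n Z i j + Z ≤ addr n Z i' j' := by
  unfold addr
  have := Nat.mul_le_mul_right Z h
  rw [add_mul (i * numBuckets n Z + j) 1 Z] at this
  omega

theorem addr_add_le_addr_succ {n Z i j j' : ℕ} (hj : j < numBuckets n Z) :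
    addr n Z i j + Z ≤ addr n Z (i + 1) j' :=
  addr_add_le (by rw [add_mul]; omega)

theorem addr_disjoint {n Z i j j' : ℕ} (h : j ≠ j') :
    addr n Z i j + Z ≤ addr n Z i j' ∨ addr n Z i j' + Z ≤ addr n Z i j := by
  rcases lt_or_gt_of_ne h with h | h
  · exact Or.inl (addr_add_le (by omega))
  · exact Or.inr (addr_add_le (by omega))

theorem addr_add_le_outAddr {n Z i j : ℕ} (hi : i ≤ levels n Z) (hj : j < numBuckets n Z) :
    addr n Z i j + Z ≤ outAddr n Z := by
  refine addr_add_le ?_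
  have := Nat.mul_le_mul_right (numBuckets n Z) hi
  rw [add_mul]
  omega

theorem slice_append_of_le {a b : ℕ} {cs ds : List α} (h : b ≤ cs.length) :
    slice a b (cs ++ ds) = slice a b cs := by
  unfold slice
  rcases Nat.le_total a b with hab | hab
  · rw [List.drop_append_of_le_length (by omega), List.take_append_of_le_length (by simp; omega)]
  · simp [Nat.sub_eq_zero_of_le hab]

theorem slice_append_right {b : ℕ} {cs ds : List α} (h : ds.length = b - cs.length) :
    slice cs.length b (cs ++ ds) = ds := by
  unfold slice
  rw [List.drop_left, List.take_of_length_le h.le]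

theorem length_slice {a b : ℕ} {cs : List α} (h : b ≤ cs.length) :
    (slice a b cs).length = b - a := by
  simp [slice]; omega

/-! ### The distribution phase -/

theorem eval_mapM_sample (B : ℕ) [NeZero B] (xs : List α) (s : Server α) :
    Client.eval ((xs.map fun x => (⟨(x : α), 0⟩ : Cell α)).mapM fun c => (do
      let k ← Client.sample (PMF.uniformOfFintype (Fin B))
      pure (⟨c.val, k⟩ : Cell α) : Client α (Cell α))) s =
      (keyed B xs).bind fun cs => PMF.pure (some (cs.map toCell), s) := by
  induction xs with
  | nil => simp [keyed, Client.eval_pure]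
  | cons x xs ih =>
    rw [List.map_cons, List.mapM_cons, bind_assoc,
      Client.eval_bind_of_bind (Client.eval_sample _ _)]
    simp only [pure_bind, keyed, PMF.bind_bind, PMF.pure_bind]
    congr 1
    funext k
    rw [Client.eval_bind_of_bind ih]
    rfl

theorem readList_init {n : ℕ} (X : Fin n → α) {m : ℕ → Cell α}
    (hm : ∀ a < n, m a = (Client.init X).mem a) {lo hi : ℕ} (hhi : hi ≤ n) :
    ((List.range (hi - lo)).map fun s => m (lo + s)) =
      (slice lo hi (List.ofFn X)).map fun x => (⟨(x : α), 0⟩ : Cell α) := by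
  apply List.ext_getElem
  · simp [length_slice, hhi]
  · intro s h1 h2
    simp only [List.length_map, List.length_range] at h1
    have h3 : lo + s < n := by omega
    rw [List.getElem_map, List.getElem_range, hm _ h3]
    simp [Client.init, h3, slice]

/-- What holds after the distribution of the first `J` groups. -/
structure Distributed {n : ℕ} (Z : ℕ) (X : Fin n → α) (J : ℕ) (cs : List (α × ℕ))
    (s : Server α) : Prop where
  input : ∀ a < n, s.mem a = (Client.init X).mem a
  bucket : ∀ j < J, Holds Z s.mem (addr n Z 0 j)
    (slice (groupStart n Z j) (groupStart n Z (j + 1)) cs)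
  blank : ∀ a, outAddr n Z ≤ a → s.mem a = Cell.dummy
  trace : s.trace = distributeTrace n Z J

theorem le_addr (n Z i j : ℕ) : n ≤ addr n Z i j := Nat.le_add_right _ _

theorem eval_distribute_range {n Z : ℕ} (hZ : 0 < Z) (X : Fin n → α) {J : ℕ}
    (hJ : J ≤ numBuckets n Z) : ∃ st : List (α × ℕ) → Server α,
      Client.eval ((List.range J).forM fun j => (do
        let lo := j * n / numBuckets n Z
        let hi := (j + 1) * n / numBuckets n Z
        let g ← Client.readList lo (hi - lo)
        let g' ← g.mapM fun c => do
          let k ← Client.sample (PMF.uniformOfFintype (Fin (numBuckets n Z)))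
          pure (⟨c.val, k⟩ : Cell α)
        Client.writeBucket Z (addr n Z 0 j) g' : Client α Unit)) (Client.init X) =
        (keyed (numBuckets n Z) ((List.ofFn X).take (groupStart n Z J))).bind
          (fun cs => PMF.pure (some (), st cs)) ∧
      ∀ cs, cs.length = groupStart n Z J → Distributed Z X J cs (st cs) := by
  induction J with
  | zero =>
    refine ⟨fun _ => Client.init X, ?_, fun cs _ => ⟨fun _ _ => rfl, by simp, ?_, rfl⟩⟩
    · simp [groupStart, keyed, Client.eval_pure]
    · intro a ha
      have := le_addr n Z (levels n Z + 1) 0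
      exact dif_neg (by unfold outAddr at ha; omega)
  | succ J ih =>
    obtain ⟨st, hst, hinv⟩ := ih (by omega)
    set g := groupStart n Z with hg
    have hgn : g (J + 1) ≤ n := by
      rw [← groupStart_numBuckets n Z]
      exact groupStart_mono n Z hJ
    have hgm : g J ≤ g (J + 1) := groupStart_mono n Z (Nat.le_succ J)
    -- The first `g J` keyed entries determine the state before this group; the remaining entries
    -- are the group itself.
    refine ⟨fun cs => ⟨Client.storeAt Z (addr n Z 0 J) ((cs.drop (g J)).map toCell)
      (st (cs.take (g J))).mem, (st (cs.take (g J))).trace ++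
        (Client.accesses .read (g J) (g (J + 1) - g J) ++
          Client.accesses .write (addr n Z 0 J) Z)⟩, ?_, ?_⟩
    · rw [show (List.ofFn X).take (g (J + 1)) =
          (List.ofFn X).take (g J) ++ slice (g J) (g (J + 1)) (List.ofFn X) by
        have := slice_append_slice (Nat.zero_le (g J)) hgm (List.ofFn X)
        simpa [slice] using this.symm]
      rw [keyed_append]
      rw [Client.forM_range_succ, Client.eval_bind_of_bind hst, PMF.bind_bind]
      refine PMF.bind_congr_support _ fun cs hcs => ?_
      have hlen : cs.length = g J := by
        rw [← List.length_map, (keyed_support hcs).1]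
        simp; omega
      rw [Client.eval_bind_of_pure (Client.eval_readList _ _ _), show J * n / numBuckets n Z = g J from rfl,
        show (J + 1) * n / numBuckets n Z = g (J + 1) from rfl, readList_init X (hinv cs hlen).input hgn,
        Client.eval_bind_of_bind (eval_mapM_sample _ _ _), PMF.bind_bind]
      congr 1
      funext ds
      rw [Client.eval_writeBucket, PMF.pure_bind, ← hlen]
      simp
    · intro cs hcs
      have hI := hinv (cs.take (g J)) (by simp; omega)
      have hlt : (cs.take (g J)).length = g J := by simp; omega
      have hld : (cs.drop (g J)).length = g (J + 1) - (cs.take (g J)).length := by simp; omega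
      refine ⟨fun a ha => ?_, fun j hj => ?_, fun a ha => ?_, ?_⟩
      · rw [← hI.input a ha]
        exact Client.storeAt_of_lt _ _ (ha.trans_le (le_addr _ _ _ _))
      · conv => arg 4; rw [← List.take_append_drop (g J) cs]
        rcases Nat.lt_succ_iff_lt_or_eq.1 hj with hj | rfl
        · rw [slice_append_of_le (by rw [hlt]; exact groupStart_mono n Z hj)]
          exact (hI.bucket j hj).storeAt_of_disjoint (addr_disjoint hj.ne) _
        · have h3 := slice_append_right hld
          rw [hlt] at h3
          rw [← hg, h3]
          refine holds_storeAt _ _ ?_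
          rw [hld, hlt]
          exact group_le hZ n j
      · rw [← hI.blank a ha]
        exact Client.storeAt_of_le _ _ ((addr_add_le_outAddr (Nat.zero_le _) (by omega)).trans ha)
      · change (st _).trace ++ _ = _
        rw [hI.trace]
        simp [distributeTrace, List.range_succ, hg]

theorem eval_distribute {n Z : ℕ} (hZ : 0 < Z) (X : Fin n → α) :
    ∃ st : List (α × ℕ) → Server α, Client.eval (distribute n Z) (Client.init X) =
        (keyed (numBuckets n Z) (List.ofFn X)).bind (fun cs => PMF.pure (some (), st cs)) ∧
      ∀ cs, cs.length = n → Distributed Z X (numBuckets n Z) cs (st cs) := by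
  have h := eval_distribute_range hZ X le_rfl
  rw [groupStart_numBuckets, List.take_of_length_le (by simp)] at h
  exact h

/-! ### The butterfly network -/

/-- The outputs are a parameter `r`, constrained in the form that `content_succ` provides, so that
they can be named as contents of the next array. -/
theorem eval_mergeSplit {Z L i a₀ a₁ b₀ b₁ : ℕ} {s : Server α} {l₀ l₁ : List (α × ℕ)}
    (h₀ : Holds Z s.mem a₀ l₀) (h₁ : Holds Z s.mem a₁ l₁) {r : Bool → List (α × ℕ)}
    (hr : ∀ v, r v = (l₀ ++ l₁).filter fun c => c.2.testBit (L - 1 - i) == v) :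
    (Z < (r false).length ∨ Z < (r true).length) ∧
        (∃ s', Client.eval (mergeSplit Z L i a₀ a₁ b₀ b₁) s = PMF.pure (none, s')) ∨
      ((r false).length ≤ Z ∧ (r true).length ≤ Z) ∧
        Client.eval (mergeSplit Z L i a₀ a₁ b₀ b₁) s = PMF.pure (some (),
          ⟨Client.storeAt Z b₁ ((r true).map toCell)
            (Client.storeAt Z b₀ ((r false).map toCell) s.mem),
            s.trace ++ mergeSplitTrace Z a₀ a₁ b₀ b₁⟩) := by
  have e₀ : ((l₀ ++ l₁).map toCell).filter (fun c => !c.key.testBit (L - 1 - i)) =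
      (r false).map toCell := by
    rw [hr, List.filter_map]
    congr 2
    funext c
    simp [toCell]
  have e₁ : ((l₀ ++ l₁).map toCell).filter (fun c => c.key.testBit (L - 1 - i)) =
      (r true).map toCell := by
    rw [hr, List.filter_map]
    congr 2
    funext c
    simp [toCell]
  unfold mergeSplit
  rw [Client.eval_bind_of_pure (Client.eval_readList _ _ _),
    Client.eval_bind_of_pure (Client.eval_readList _ _ _)]
  simp only [List.filter_append, h₀.filter_isReal, h₁.filter_isReal]
  simp only [← List.filter_append, ← List.map_append, e₀, e₁, List.length_map]
  by_cases h : Z < (r false).length ∨ Z < (r true).length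
  · rw [if_pos h]
    exact Or.inl ⟨h, _, Client.eval_abort _⟩
  · rw [if_neg h, Client.eval_bind_of_pure (Client.eval_writeBucket _ _ _ _),
      Client.eval_writeBucket]
    push Not at h
    exact Or.inr ⟨h, by simp [mergeSplitTrace]⟩

/-- What holds after the first `i` levels of the network and the first `J` operations of the
next one. -/
structure Routed (n Z i J : ℕ) (cs : List (α × ℕ)) (s : Server α) : Prop where
  bucket : ∀ b < numBuckets n Z, Holds Z s.mem (addr n Z i b) (content n Z i b cs)
  next : ∀ b < 2 * J, Holds Z s.mem (addr n Z (i + 1) b) (content n Z (i + 1) b cs)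
  blank : ∀ a, outAddr n Z ≤ a → s.mem a = Cell.dummy
  trace : s.trace = binAssignTrace n Z i ++ levelTrace n Z i J

theorem two_mul_half_numBuckets {n Z i : ℕ} (hi : i < levels n Z) :
    2 * (numBuckets n Z / 2) = numBuckets n Z ∧
      2 ^ i ∣ numBuckets n Z / 2 := by
  obtain ⟨l, hl⟩ : ∃ l, levels n Z = l + 1 := ⟨levels n Z - 1, by omega⟩
  have : numBuckets n Z / 2 = 2 ^ l := by rw [numBuckets, hl, pow_succ]; simp
  rw [this, numBuckets, hl, pow_succ, mul_comm]
  exact ⟨rfl, pow_dvd_pow _ (by omega)⟩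

/-- `2 ^ i` divides `numBuckets / 2`, so the pair of blocks containing the sources lies entirely
within the array. -/
theorem source_lt {n Z i j : ℕ} (hi : i < levels n Z) (hj : j < numBuckets n Z / 2) :
    j / 2 ^ i * 2 ^ i + j + 2 ^ i < numBuckets n Z := by
  obtain ⟨h1, d, hd⟩ := two_mul_half_numBuckets hi
  have hp : 0 < 2 ^ i := by positivity
  have h2 : j / 2 ^ i + 1 ≤ d := by
    rw [Nat.succ_le_iff, Nat.div_lt_iff_lt_mul hp, mul_comm, ← hd]
    exact hj
  have h3 := Nat.mul_le_mul_right (2 ^ i) h2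
  rw [add_mul, one_mul, mul_comm d, ← hd] at h3
  omega

/-- Only array `i + 1` is written, so the sources survive the whole level. As they hold their exact
contents, an abort exhibits a `content` longer than `Z`. -/
theorem eval_level_range {n Z i : ℕ} (hi : i < levels n Z) {cs : List (α × ℕ)} {s : Server α}
    (hs : Routed n Z i 0 cs s) {J : ℕ} (hJ : J ≤ numBuckets n Z / 2) {P : Client α Unit}
    (hP : P = (List.range J).forM fun j =>
      let j' := j / 2 ^ i * 2 ^ i
      mergeSplit Z (levels n Z) i
        (addr n Z i (j' + j)) (addr n Z i (j' + j + 2 ^ i))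
        (addr n Z (i + 1) (2 * j)) (addr n Z (i + 1) (2 * j + 1))) :
    (∃ s', Client.eval P s = PMF.pure (some (), s') ∧ Routed n Z i J cs s') ∨
      Overflow n Z cs ∧ ∃ s', Client.eval P s = PMF.pure (none, s') := by
  obtain ⟨hB, -⟩ := two_mul_half_numBuckets hi
  subst hP
  induction J with
  | zero => exact Or.inl ⟨s, Client.eval_pure _ _, hs⟩
  | succ J ih =>
    rw [Client.forM_range_succ]
    rcases ih (by omega) with ⟨s₁, h₁, hI⟩ | ⟨ho, s₁, h₁⟩
    · have hlt := source_lt hi (show J < numBuckets n Z / 2 by omega)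
      rw [Client.eval_bind_of_pure h₁]
      rcases eval_mergeSplit (L := levels n Z) (i := i) (b₀ := addr n Z (i + 1) (2 * J))
        (b₁ := addr n Z (i + 1) (2 * J + 1)) (hI.bucket (J / 2 ^ i * 2 ^ i + J) ((Nat.le_add_right _ _).trans_lt hlt))
        (hI.bucket (J / 2 ^ i * 2 ^ i + J + 2 ^ i) hlt)
        (fun v => content_succ hi cs v) with ⟨ho, s₂, h₂⟩ | ⟨⟨hf, ht⟩, h₂⟩
      · refine Or.inr ⟨?_, s₂, h₂⟩
        rcases ho with ho | ho
        · exact ⟨i, hi, 2 * J, by omega, ho⟩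
        · exact ⟨i, hi, 2 * J + 1, by omega, ho⟩
      · refine Or.inl ⟨_, h₂, ?_⟩
        simp only [Bool.toNat_false, Bool.toNat_true, add_zero] at hf ht ⊢
        refine ⟨fun b hb => ?_, fun b hb => ?_, fun a ha => ?_, ?_⟩
        · exact ((hI.bucket b hb).storeAt_of_disjoint (Or.inl (addr_add_le_addr_succ hb)) _
            ).storeAt_of_disjoint (Or.inl (addr_add_le_addr_succ hb)) _
        · rcases lt_trichotomy b (2 * J) with h | rfl | h
          · exact ((hI.next b h).storeAt_of_disjoint (addr_disjoint (by omega)) _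
              ).storeAt_of_disjoint (addr_disjoint (by omega)) _
          · exact (holds_storeAt _ _ hf).storeAt_of_disjoint (addr_disjoint (by omega)) _
          · obtain rfl : b = 2 * J + 1 := by omega
            exact holds_storeAt _ _ ht
        · have h3 := @addr_add_le_outAddr n Z (i + 1) (2 * J) (by omega) (by omega)
          have h4 := @addr_add_le_outAddr n Z (i + 1) (2 * J + 1) (by omega) (by omega)
          change Client.storeAt _ _ _ (Client.storeAt _ _ _ _) a = _
          rw [Client.storeAt_of_le _ _ (h4.trans ha), Client.storeAt_of_le _ _ (h3.trans ha),
            hI.blank a ha]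
        · simp [hI.trace, levelTrace, List.range_succ]
    · exact Or.inr ⟨ho, s₁, Client.eval_bind_of_none h₁ _⟩

theorem eval_network_range {n Z : ℕ} {cs : List (α × ℕ)} {s : Server α}
    (hs : Routed n Z 0 0 cs s) {I : ℕ} (hI : I ≤ levels n Z) {P : Client α Unit}
    (hP : P = (List.range I).forM fun i =>
      (List.range (numBuckets n Z / 2)).forM fun j =>
        let j' := j / 2 ^ i * 2 ^ i
        mergeSplit Z (levels n Z) i
          (addr n Z i (j' + j)) (addr n Z i (j' + j + 2 ^ i))
          (addr n Z (i + 1) (2 * j)) (addr n Z (i + 1) (2 * j + 1))) :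
    (∃ s', Client.eval P s = PMF.pure (some (), s') ∧ Routed n Z I 0 cs s') ∨
      Overflow n Z cs ∧ ∃ s', Client.eval P s = PMF.pure (none, s') := by
  subst hP
  induction I with
  | zero => exact Or.inl ⟨s, Client.eval_pure _ _, hs⟩
  | succ I ih =>
    rw [Client.forM_range_succ]
    rcases ih (by omega) with ⟨s₁, h₁, hR⟩ | ⟨ho, s₁, h₁⟩
    · rw [Client.eval_bind_of_pure h₁]
      rcases eval_level_range (by omega) hR le_rfl rfl with ⟨s₂, h₂, hR₂⟩ | ⟨ho, s₂, h₂⟩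
      · refine Or.inl ⟨s₂, h₂, ?_⟩
        have hB := (two_mul_half_numBuckets (show I < levels n Z by omega)).1
        refine ⟨fun b hb => hR₂.next b (by omega), by simp, hR₂.blank, ?_⟩
        simp [hR₂.trace, binAssignTrace, levelTrace, List.range_succ]
      · exact Or.inr ⟨ho, s₂, h₂⟩
    · exact Or.inr ⟨ho, s₁, Client.eval_bind_of_none h₁ _⟩

theorem eval_binAssign {n Z : ℕ} (hZ : 0 < Z) (X : Fin n → α) :
    ∃ st : List (α × ℕ) → Option Unit × Server α,
      Client.eval (binAssign n Z) (Client.init X) =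
        (keyed (numBuckets n Z) (List.ofFn X)).bind (fun cs => PMF.pure (st cs)) ∧
      ∀ cs, cs.length = n → (∀ c ∈ cs, c.2 < numBuckets n Z) →
        (st cs).1 = some () ∧ Routed n Z (levels n Z) 0 cs (st cs).2 ∨
          Overflow n Z cs ∧ (st cs).1 = none := by
  obtain ⟨st, hst, hD⟩ := eval_distribute hZ X
  have key : ∀ cs : List (α × ℕ), ∃ r : Option Unit × Server α,
      cs.length = n → (∀ c ∈ cs, c.2 < numBuckets n Z) →
      Client.eval ((List.range (levels n Z)).forM fun i =>
        (List.range (numBuckets n Z / 2)).forM fun j =>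
          let j' := j / 2 ^ i * 2 ^ i
          mergeSplit Z (levels n Z) i
            (addr n Z i (j' + j)) (addr n Z i (j' + j + 2 ^ i))
            (addr n Z (i + 1) (2 * j)) (addr n Z (i + 1) (2 * j + 1))) (st cs) = PMF.pure r ∧
        (r.1 = some () ∧ Routed n Z (levels n Z) 0 cs r.2 ∨ Overflow n Z cs ∧ r.1 = none) := by
    intro cs
    by_cases hc : cs.length = n ∧ ∀ c ∈ cs, c.2 < numBuckets n Z
    · have hd := hD cs hc.1
      have hR : Routed n Z 0 0 cs (st cs) := by
        refine ⟨fun b hb => ?_, by simp, hd.blank, ?_⟩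
        · rw [content_zero hc.2]
          exact hd.bucket b hb
        · simp [hd.trace, binAssignTrace, levelTrace]
      rcases eval_network_range hR le_rfl rfl with ⟨s, h1, h2⟩ | ⟨ho, s, h1⟩
      · exact ⟨_, fun _ _ => ⟨h1, Or.inl ⟨rfl, h2⟩⟩⟩
      · exact ⟨_, fun _ _ => ⟨h1, Or.inr ⟨ho, rfl⟩⟩⟩
    -- An arbitrary value for lists outside the support of the key distribution.
    · exact ⟨(none, st cs), fun h1 h2 => absurd ⟨h1, h2⟩ hc⟩
  choose r hr using key
  refine ⟨r, ?_, fun cs h1 h2 => (hr cs h1 h2).2⟩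
  rw [binAssign, Client.eval_bind_of_bind hst]
  refine PMF.bind_congr_support _ fun cs hcs => ?_
  obtain ⟨h1, h2⟩ := keyed_support hcs
  exact (hr cs (by rw [← List.length_map, h1, List.length_ofFn]) h2).1

end Bucket

namespace Bucket

variable {α : Type}

/-! ### The output phase -/

theorem listMem_append (l r : List α) (m : ℕ → Cell α) (out : ℕ)
    (hm : ∀ a, m (out + a) = CmpProg.listMem l a) (a : ℕ) :
    Client.storeAt r.length (out + l.length) (r.map fun x => (⟨(x : α), 0⟩ : Cell α)) m (out + a) =
      CmpProg.listMem (l ++ r) a := by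
  unfold CmpProg.listMem
  rcases lt_or_ge a l.length with h | h
  · rw [Client.storeAt_of_lt _ _ (by omega), hm, CmpProg.listMem, List.getElem?_append_left h]
  · rw [List.getElem?_append_right h]
    obtain ⟨b, rfl⟩ := Nat.exists_eq_add_of_le h
    rw [Nat.add_sub_cancel_left, ← add_assoc]
    rcases lt_or_ge b r.length with hb | hb
    · rw [Client.storeAt_add _ _ hb]
      simp [hb]
    · rw [Client.storeAt_of_le _ _ (by omega), add_assoc, hm, CmpProg.listMem,
        List.getElem?_eq_none (by omega), List.getElem?_eq_none hb]

theorem eval_bin {n Z j off : ℕ} {s : Server α} {l : List (α × ℕ)}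
    (h : Holds Z s.mem (addr n Z (levels n Z) j) l) :
    Client.eval (do
      let c ← Client.readList (addr n Z (levels n Z) j) Z
      let l ← Client.shuffle (c.filter Cell.isReal)
      Client.writeList (outAddr n Z + off) (l.map fun c => ⟨c.val, 0⟩)
      pure (off + l.length) : Client α ℕ) s =
      (shuf (l.map Prod.fst)).bind fun r => PMF.pure (some (off + r.length),
        ⟨Client.storeAt r.length (outAddr n Z + off) (r.map fun x => (⟨(x : α), 0⟩ : Cell α)) s.mem,
          s.trace ++ (Client.accesses .read (addr n Z (levels n Z) j) Z ++
            Client.accesses .write (outAddr n Z + off) r.length)⟩) := by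
  rw [Client.eval_bind_of_pure (Client.eval_readList _ _ _), h.filter_isReal,
    Client.eval_bind_of_bind (Client.eval_shuffle _ _), shuf_map, shuf_map, PMF.bind_map,
    PMF.bind_map]
  congr 1
  funext r
  simp only [Function.comp_apply]
  rw [Client.eval_bind_of_pure (Client.eval_writeList _ _ _), Client.eval_pure]
  simp [toCell, Function.comp_def]

/-- What holds after the output phase has processed some bins, with result `l`. -/
structure Written (n Z : ℕ) (s₀ : Server α) (load : ℕ → ℕ) (J : ℕ) (l : List α)
    (s : Server α) : Prop where
  bins : ∀ a < outAddr n Z, s.mem a = s₀.mem a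
  output : ∀ a, s.mem (outAddr n Z + a) = CmpProg.listMem l a
  trace : s.trace = s₀.trace ++ outputTrace n Z load J

theorem length_shufBins {bin : ℕ → List α} {J : ℕ} {l : List α}
    (h : l ∈ (shufBins bin J).support) :
    l.length = ((List.range J).map fun j => (bin j).length).sum := by
  rw [(shufBins_support h).length_eq, List.length_flatMap]

theorem eval_output_range {n Z : ℕ} {cs : List (α × ℕ)} (hcs : cs.length = n) {s : Server α}
    (hs : Routed n Z (levels n Z) 0 cs s) {J : ℕ} (hJ : J ≤ numBuckets n Z) :
    ∃ st : List α → Server α, Client.eval ((List.range J).foldlM (init := 0) fun off j => (do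
        let c ← Client.readList (addr n Z (levels n Z) j) Z
        let l ← Client.shuffle (c.filter Cell.isReal)
        Client.writeList (outAddr n Z + off) (l.map fun c => ⟨c.val, 0⟩)
        pure (off + l.length) : Client α ℕ)) s =
        (shufBins (bin cs) J).bind (fun l => PMF.pure (some l.length, st l)) ∧
      ∀ l, l.length = ((List.range J).map fun j => (bin cs j).length).sum →
        Written n Z s (fun j => (bin cs j).length) J l (st l) := by
  induction J with
  | zero =>
    refine ⟨fun _ => s, by simp [shufBins, Client.eval_pure], fun l hl => ⟨fun _ _ => rfl, ?_, ?_⟩⟩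
    · intro a
      rw [hs.blank _ (Nat.le_add_right _ _), List.length_eq_zero_iff.1 hl]
      rfl
    · simp [outputTrace]
  | succ J ih =>
    obtain ⟨st, hst, hinv⟩ := ih (by omega)
    set N := ((List.range J).map fun j => (bin cs j).length).sum with hN
    -- The previous bins fill exactly `N` output cells, so `l` splits at `N` into the earlier output
    -- and the new bin.
    refine ⟨fun l => ⟨Client.storeAt (l.drop N).length (outAddr n Z + N)
      ((l.drop N).map fun x => (⟨(x : α), 0⟩ : Cell α)) (st (l.take N)).mem,
      (st (l.take N)).trace ++ (Client.accesses .read (addr n Z (levels n Z) J) Z ++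
            Client.accesses .write (outAddr n Z + N) (l.drop N).length)⟩, ?_, ?_⟩
    · rw [List.range_succ, List.foldlM_append, Client.eval_bind_of_bind hst, shufBins, PMF.bind_bind]
      refine PMF.bind_congr_support _ fun acc hacc => ?_
      have hlen : acc.length = N := length_shufBins hacc
      have hH : Holds Z (st acc).mem (addr n Z (levels n Z) J)
          (cs.filter fun c => c.2 = J) := by
        have hb := hs.bucket J (by omega)
        rw [content_levels (by omega) hcs] at hb
        refine hb.congr fun a ha => (hinv acc hlen).bins _ ?_
        have := @addr_add_le_outAddr n Z _ J le_rfl (by omega)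
        omega
      rw [List.foldlM_cons]
      simp only [List.foldlM_nil, bind_pure]
      rw [eval_bin hH, PMF.bind_bind]
      change PMF.bind (shuf (bin cs J)) _ = _
      congr 1
      funext r
      rw [PMF.pure_bind, ← hlen]
      simp
    · intro l hl
      rw [List.range_succ, List.map_append, List.sum_append, ← hN] at hl
      simp only [List.map_cons, List.map_nil, List.sum_cons, List.sum_nil, add_zero] at hl
      have hlt : (l.take N).length = N := by simp; omega
      have hld : (l.drop N).length = (bin cs J).length := by simp; omega
      have hW := hinv _ hlt
      refine ⟨fun a ha => ?_, fun a => ?_, ?_⟩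
      · rw [← hW.bins a ha]
        exact Client.storeAt_of_lt _ _ (by omega)
      · have := listMem_append (l.take N) (l.drop N) _ _ hW.output a
        rwa [hlt, List.take_append_drop] at this
      · change (st _).trace ++ _ = _
        rw [hW.trace, hld]
        simp [outputTrace, List.range_succ, hN]

/-- Every entry lies in exactly one bin; the induction splits off the bin of the largest key. -/
theorem bins_perm {B : ℕ} {cs : List (α × ℕ)} (hcs : ∀ c ∈ cs, c.2 < B) :
    ((List.range B).flatMap (bin cs)).Perm (cs.map Prod.fst) := by
  have : (List.range B).flatMap (bin cs) =
      ((List.range B).flatMap fun b => cs.filter fun c => c.2 = b).map Prod.fst := by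
    rw [List.map_flatMap]
    rfl
  rw [this]
  refine List.Perm.map _ ?_
  clear this
  induction B generalizing cs with
  | zero =>
    rcases cs with _ | ⟨c, cs⟩
    · simp
    · simpa using hcs c (by simp)
  | succ B ih =>
    rw [List.range_succ, List.flatMap_append]
    simp only [List.flatMap_cons, List.flatMap_nil, List.append_nil]
    have h := ih (cs := cs.filter fun c => !decide (c.2 = B)) (fun c hc => by
      simp only [List.mem_filter, Bool.not_eq_true', decide_eq_false_iff_not] at hc
      have := hcs c hc.1
      omega)
    have h2 : ((List.range B).flatMap fun b => cs.filter fun c => c.2 = b) =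
        (List.range B).flatMap fun b =>
          (cs.filter fun c => !decide (c.2 = B)).filter fun c => c.2 = b := by
      rw [List.flatMap_def, List.flatMap_def]
      congr 1
      refine List.map_congr_left fun b hb => ?_
      rw [List.filter_filter]
      congr 1
      funext c
      rw [List.mem_range] at hb
      rw [Bool.eq_iff_iff]
      simp only [decide_eq_true_eq, Bool.and_eq_true, Bool.not_eq_true', decide_eq_false_iff_not]
      omega
    rw [h2]
    exact (List.perm_append_comm.trans (List.Perm.append_left _ h)).trans
      (List.filter_append_perm (fun c : α × ℕ => decide (c.2 = B)) cs)

/-! ### Bucket oblivious sort -/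

theorem injective_tagged {n : ℕ} (X : Fin n → α) :
    Function.Injective fun i => (toLex (X i, i) : α ×ₗ Fin n) := by
  intro i j h
  simpa using congrArg (fun p => (ofLex p).2) h

variable [LinearOrder α]

/-- For fixed keys the remaining randomness is that of the shuffles and of `S`, just as in
`idealTrace`; the output is constant because `S` sorts every rearrangement of `X` to the same array.
-/
theorem exec_afterAssign {n Z : ℕ} {S : CmpProg} (hS : S.Sorts n) (X : Fin n → α)
    {cs : List (α × ℕ)} (hX : cs.map Prod.fst = List.ofFn X)
    (hB : ∀ c ∈ cs, c.2 < numBuckets n Z) {s : Server α} (hs : Routed n Z (levels n Z) 0 cs s) :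
    (Client.eval (do
      let _ ← (List.range (numBuckets n Z)).foldlM (init := 0) fun off j => do
        let c ← Client.readList (addr n Z (levels n Z) j) Z
        let l ← Client.shuffle (c.filter Cell.isReal)
        Client.writeList (outAddr n Z + off) (l.map fun c => ⟨c.val, 0⟩)
        pure (off + l.length)
      S.run (outAddr n Z) fun _ => Cell.dummy : Client α Unit) s).map
        (fun r => (r.2.trace, r.1.map fun _ (i : Fin n) => (r.2.mem (outAddr n Z + i)).val)) =
      (idealTrace n Z S cs).map fun t => (t, some (sortedArray X)) := by
  have hlen : cs.length = n := by rw [← List.length_map, hX, List.length_ofFn]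
  obtain ⟨st, hst, hW⟩ := eval_output_range hlen hs le_rfl
  rw [Client.eval_bind_of_bind hst, PMF.map_bind, idealTrace, PMF.map_bind]
  refine PMF.bind_congr_support _ fun l hl => ?_
  have hw := hW l (length_shufBins hl)
  have hmem : (fun x => (st l).mem (outAddr n Z + x)) = CmpProg.listMem l := funext hw.output
  have hperm : l.Perm (List.ofFn X) := by
    rw [← hX]
    exact (shufBins_support hl).trans (bins_perm hB)
  obtain ⟨Y, rfl⟩ : ∃ Y : Fin n → α, l = List.ofFn Y := by
    have h1 : l.length = n := by rw [hperm.length_eq, List.length_ofFn]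
    subst h1
    exact ⟨l.get, (List.ofFn_get l).symm⟩
  rw [CmpProg.eval_run, hmem, PMF.map_comp, CmpProg.accessPattern, PMF.map_comp, PMF.map_comp]
  refine PMF.map_congr_support _ fun r hr => ?_
  simp only [Function.comp_apply, CmpProg.finish, Option.map_some, Prod.mk.injEq, Option.some.injEq]
  constructor
  · rw [hw.trace, hs.trace]
    simp [levelTrace]
  · rw [← sortedArray_eq_of_perm hperm, ← hS.sem_val Y hr]
    funext i
    simp

/-- The real experiment, conditioned on the keys, coincides with the ideal one, unless there is an
overflow; then it aborts. -/
theorem execSort_eq {n Z : ℕ} (hZ : 0 < Z) {S : CmpProg} (hS : S.Sorts n) (X : Fin n → α) :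
    ∃ real : List (α × ℕ) → PMF (List Access × Option (Fin n → WithBot α)),
      execSort Z S X = (keyed (numBuckets n Z) (List.ofFn X)).bind real ∧
      ∀ cs ∈ (keyed (numBuckets n Z) (List.ofFn X)).support,
        real cs = (idealTrace n Z S cs).map (fun t => (t, some (sortedArray X))) ∨
          Overflow n Z cs ∧ ∃ t, real cs = PMF.pure (t, none) := by
  obtain ⟨st, hst, hR⟩ := eval_binAssign hZ X
  unfold execSort sort orp
  rw [Client.exec_eq]
  simp only [bind_assoc, pure_bind]
  rw [Client.eval_bind, hst, PMF.bind_bind, PMF.map_bind]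
  refine ⟨_, rfl, fun cs hcs => ?_⟩
  obtain ⟨h1, h2⟩ := keyed_support hcs
  rw [PMF.pure_bind]
  rcases hR cs (by rw [← List.length_map, h1, List.length_ofFn]) h2 with ⟨h3, h4⟩ | ⟨h3, h4⟩
  · left
    rw [h3]
    exact exec_afterAssign hS X h1 h2 h4
  · right
    refine ⟨h3, (st cs).2.trace, ?_⟩
    rw [h4]
    simp only [PMF.pure_map]
    rfl

theorem outputs_execSort {n Z : ℕ} (hZ : 0 < Z) {S : CmpProg} (hS : S.Sorts n) (X : Fin n → α) :
    Outputs (err n Z) (sortedArray X) (execSort Z S X) := by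
  obtain ⟨real, hreal, hcases⟩ := execSort_eq hZ hS X
  rw [hreal]
  constructor
  · intro o ho
    rw [PMF.mem_support_bind_iff] at ho
    obtain ⟨cs, hcs, ho⟩ := ho
    rcases hcases cs hcs with h | ⟨-, t, h⟩
    · rw [h, PMF.mem_support_map_iff] at ho
      obtain ⟨t, -, rfl⟩ := ho
      exact Or.inr rfl
    · rw [h, PMF.mem_support_pure_iff] at ho
      exact Or.inl (by rw [ho])
  · rw [PMF.map_bind]
    -- The comparison is with an experiment that never aborts, so the difference at `none` is the
    -- abort probability itself.
    have key := PMF.abs_bind_sub_bind_le (keyed (numBuckets n Z) (List.ofFn X))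
      (fun cs => (real cs).map fun o => o.2) (fun _ => PMF.pure (some (sortedArray X)))
      {cs | Overflow n Z cs} (fun cs hcs hno => by
        rcases hcases cs hcs with h | ⟨ho, -⟩
        · rw [h, PMF.map_comp]
          exact PMF.map_const _ _
        · exact absurd ho hno) none
    rw [PMF.bind_const, PMF.pure_apply_of_ne _ _ (by simp), ENNReal.toReal_zero, sub_zero] at key
    exact (le_abs_self _).trans (key.trans (overflow_le_err hZ n _))

theorem simulates_execSort {n Z : ℕ} (hZ : 0 < Z) {S : CmpProg} (hS : S.Sorts n) {X : Fin n → α}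
    (hX : Function.Injective X) :
    Simulates (simulator n Z S) (err n Z) (sortedArray X) (execSort Z S X) := by
  obtain ⟨real, hreal, hcases⟩ := execSort_eq hZ hS X
  intro A
  rw [hreal, ← keyed_bind_idealTrace Z S hX, PMF.map_bind, PMF.bind_bind, PMF.bind_bind]
  refine (PMF.abs_bind_sub_bind_le _ _ _ {cs | Overflow n Z cs} (fun cs hcs hno => ?_) true).trans
    (overflow_le_err hZ n _)
  rcases hcases cs hcs with h | ⟨ho, -⟩
  · rw [h]
  · exact absurd ho hno

/-! ### Ties -/

theorem sortedArray_tagged {n : ℕ} (X : Fin n → α) :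
    (fun i => (sortedArray (fun i => (toLex (X i, i) : α ×ₗ Fin n)) i).map
      fun p => (ofLex p).1) = sortedArray X := by
  -- The permutation sorting `T` also makes the first components monotone, and any permutation that
  -- sorts `X` yields the same array.
  set T : Fin n → α ×ₗ Fin n := fun i => toLex (X i, i)
  have hmono : Monotone (X ∘ Tuple.sort T) := by
    intro i j hij
    have h : T (Tuple.sort T i) ≤ T (Tuple.sort T j) := Tuple.monotone_sort T hij
    rcases Prod.Lex.le_iff.1 h with h | h
    · exact h.le
    · exact h.1.le
  have := Tuple.comp_sort_eq_comp_iff_monotone.2 hmono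
  funext i
  exact congrArg _ (congrFun this i)

theorem outputs_execSortTagged {n Z : ℕ} (hZ : 0 < Z) {S : CmpProg} (hS : S.Sorts n)
    (X : Fin n → α) : Outputs (err n Z) (sortedArray X) (execSortTagged Z S X) := by
  obtain ⟨h1, h2⟩ := outputs_execSort hZ hS fun i => (toLex (X i, i) : α ×ₗ Fin n)
  unfold execSortTagged
  constructor
  · intro o ho
    rw [PMF.mem_support_map_iff] at ho
    obtain ⟨o, ho, rfl⟩ := ho
    rcases h1 o ho with h | h
    · exact Or.inl (by simp [h])
    · right
      rw [h, ← sortedArray_tagged X]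
      rfl
  · refine le_of_eq_of_le ?_ h2
    rw [PMF.map_comp, PMF.map_apply, PMF.map_apply]
    congr 1
    refine tsum_congr fun o => ?_
    rcases o with ⟨t, _ | Y⟩ <;> simp

theorem simulates_execSortTagged {n Z : ℕ} (hZ : 0 < Z) {S : CmpProg} (hS : S.Sorts n)
    (X : Fin n → α) :
    Simulates (simulator n Z S) (err n Z) (sortedArray X) (execSortTagged Z S X) := by
  intro A
  -- Dropping the tags is absorbed into the distinguisher. The simulator runs on `Fin n` alone, so
  -- it is the same for the tagged type.
  have h := simulates_execSort hZ hS (injective_tagged X) fun o =>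
    A (o.1, o.2.map fun Y i => (Y i).map fun p => (ofLex p).1)
  rw [execSortTagged, PMF.bind_map, PMF.bind_map, ← sortedArray_tagged X]
  rw [PMF.bind_map] at h
  exact h

end Bucket

theorem mainTheorem3 (n Z : ℕ) (hZ : 0 < Z) (S : CmpProg) (hS : S.Sorts n) :
    (∀ (α : Type) [LinearOrder α] (X : Fin n → α),
      Outputs (Bucket.err n Z) (sortedArray X) (Bucket.execSort Z S X) ∧
      Outputs (Bucket.err n Z) (sortedArray X) (Bucket.execSortTagged Z S X)) ∧
    ∃ Sim : PMF (List Access), ∀ (α : Type) [LinearOrder α] (X : Fin n → α),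
      (Function.Injective X →
        Simulates Sim (Bucket.err n Z) (sortedArray X) (Bucket.execSort Z S X)) ∧
      Simulates Sim (Bucket.err n Z) (sortedArray X) (Bucket.execSortTagged Z S X) :=
  ⟨fun _ _ X => ⟨Bucket.outputs_execSort hZ hS X, Bucket.outputs_execSortTagged hZ hS X⟩,
    Bucket.simulator n Z S, fun _ _ X =>
      ⟨Bucket.simulates_execSort hZ hS, Bucket.simulates_execSortTagged hZ hS X⟩⟩
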